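/- Let $\mathbb N=\{1,2,\dots\}$ and let $\mathbb V=\mathbb N^\star$ be the set of finite words over $\mathbb N$. The random recursive tree chain starts with a single node $1$; node $k+1$ is attached to a direct ancestor chosen uniformly at random from the nodes $1,\dots,k$, independently of the past. The Harris chain $X=(X_n)_{n\in\mathbb N}$ is obtained by mapping nodes to words in $\mathbb V$: the root is mapped to $\emptyset$, and if node $j$ is the $i$-th child (in order of arrival) of a node with word $u$, then $j$ is mapped to $ui$; $X_n\subset\mathbb V$ is the set of words of the nodes $1,\dots,n$. For a finite set $x\subset\mathbb V$ and $u\in\mathbb V$ let $\#x(u)$ be the number of elements of $x$ with prefix $u$. Let $\bar{\mathbb V}$ consist of all finite and all infinite words over $\mathbb N$ and of all finite words continued by infinitely many symbols $\infty$, let $A_u\subset\bar{\mathbb V}$ be the set of elements with prefix $u\in\mathbb V$, and endow $\bar{\mathbb V}$ with the $\sigma$-field generated by the sets $A_u$. Let the random probability measure $X_\infty$ on $\bar{\mathbb V}$ be the almost sure limit of $X_n$ in the Doob-Martin topology, that is, almost surely $\frac1n\#X_n(u)\to X_\infty(A_u)$ for all $u\in\mathbb V$. Put $$\rho(X_\infty,u)=\bigl(\rho_i(X_\infty,u)\bigr)_{i\in\mathbb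 N},\qquad \rho_i(X_\infty,u)=\frac{X_\infty(A_{ui})}{X_\infty(A_u)} .$$ For $a=(a_1,\dots,a_k)$, $k\ge 0$, with positive integers $a_i$, let $\mathrm{GEM}(a)$ be the law of $\xi=(\xi_i)_{i\in\mathbb N}$ with $\xi_i=\zeta_i\prod_{j<i}(1-\zeta_j)$, where the $\zeta_i$ are independent, $\zeta_i\sim\mathrm{Beta}\bigl(a_i,1+\sum_{j=i+1}^k a_j\bigr)$ for $i\le k$ (so $\zeta_k\sim\mathrm{Beta}(a_k,1)$), and $\zeta_i\sim\mathrm{Beta}(1,1)$ for $i>k$. **Theorem 4.** Almost surely, for all $u\in\mathbb V$, $X_\infty(A_u)>0$ and $\rho(X_\infty,u)$ is a sequence of non-negative numbers with sum $1$. Let $n\in\mathbb N$. For every $u\in\mathbb V$ the conditional distribution of $\rho(X_\infty,u)$ given $X_n$ is $\mathrm{GEM}(a)$, where $a=(a_1,\dots,a_k)$ with $$k=\max\{i\in\mathbb N:\ \#X_n(ui)>0\}\quad(k=0\text{ if there is no such }i),\qquad a_i=\#X_n(ui)\ \text{ for } i=1,\dots,k .$$ Further, the random sequences $\rho(X_\infty,u)$,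 $u\in\mathbb V$, are conditionally independent given $X_n$. -/

import Mathlib

open MeasureTheory ProbabilityTheory Filter Topology

/-! Natural numbers used as letters of words and as indices of sequences start at `0` below: the
letter, child or component with number `i` of the mathematical text is `i - 1` here. Sizes and the
time parameter are not shifted. -/

namespace HarrisChain

/-- The potential tree nodes: finite words over the natural numbers; the root is `[]`. -/
abbrev Node : Type := List ℕ

/-! ### Random recursive trees and the Harris chain -/

/-- The space of encodings of growing sequences of recursive trees. The nodes of the recursive trees
are `0, 1, 2, …`, and `j k` is the direct ancestor of node `k + 1`, one of the nodes `0, …, k`. The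
recursive tree with `n` nodes is the tree on `{0, …, n - 1}` given by `j 0, …, j (n - 2)`. -/
abbrev RecSeq : Type := ∀ k : ℕ, Fin (k + 1)

/-- The law of the RRT chain: the direct ancestor of each new node is chosen uniformly at random
from the nodes of the current tree, independently of the past. -/
noncomputable def rrtLaw : Measure RecSeq :=
  Measure.infinitePi fun k => (PMF.uniformOfFintype (Fin (k + 1))).toMeasure

/-- The word that a node of the recursive tree is mapped to: the word of its direct ancestor,
followed by its position among the children of that ancestor (in order of arrival). -/
def word (j : RecSeq) : ℕ → Node
  | 0 => []
  | k + 1 => word j (j k) ++ [((Finset.range k).filter fun i => (j i : ℕ) = (j k : ℕ)).card]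
decreasing_by exact (j k).isLt

/-- The Harris tree of the recursive tree with `n` nodes, as a function of the encoding
(the tree with no node at all if `n = 0`). -/
def harrisTree (j : RecSeq) (n : ℕ) : Finset Node :=
  (Finset.range n).image (word j)

theorem word_congr {j j' : RecSeq} (k : ℕ) (h : ∀ i < k, j i = j' i) : word j k = word j' k := by
  induction k using Nat.strong_induction_on with
  | _ k ih =>
    cases k with
    | zero => rw [word, word]
    | succ k =>
      have hk : j k = j' k := h k (Nat.lt_succ_self k)
      have h1 : word j (j k) = word j' (j k) :=
        ih _ (j k).isLt fun i hi => h i (hi.trans (j k).isLt)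
      have h2 : ((Finset.range k).filter fun i => (j i : ℕ) = (j k : ℕ))
          = (Finset.range k).filter fun i => (j' i : ℕ) = (j' k : ℕ) := by
        apply Finset.filter_congr
        intro i hi
        rw [h i ((Finset.mem_range.1 hi).trans (Nat.lt_succ_self k)), hk]
      rw [word, word, h1, h2, hk]

theorem measurable_harrisTree : Measurable harrisTree := by
  refine measurable_pi_iff.2 fun n => ?_
  let ext : (∀ i : Finset.range n, Fin ((i : ℕ) + 1)) → RecSeq :=
    fun f i => if h : i ∈ Finset.range n then f ⟨i, h⟩ else 0
  have h : (fun j : RecSeq => harrisTree j n)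
      = (fun f => harrisTree (ext f) n) ∘ (Finset.range n).restrict := by
    funext j
    refine Finset.image_congr fun k hk => word_congr k fun i hi => ?_
    have hi' : i ∈ Finset.range n := Finset.mem_range.2 (hi.trans (Finset.mem_range.1 hk))
    simp only [ext, hi', dif_pos, Finset.restrict]
  rw [h]
  exact (measurable_of_countable _).comp (Finset.measurable_restrict _)

/-- The law of the Harris chain `(X_n)`, the image of the RRT chain. -/
noncomputable def harrisLaw : Measure (ℕ → Finset Node) :=
  rrtLaw.map harrisTree

instance : IsProbabilityMeasure rrtLaw := by
  unfold rrtLaw; infer_instance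

instance : IsProbabilityMeasure harrisLaw :=
  Measure.isProbabilityMeasure_map measurable_harrisTree.aemeasurable

/-! ### Subtree sizes -/

/-- `#x(u)`, the number of nodes of `x` that have `u` as a prefix, i.e. the number of `v` such that
`u ++ v` is in `x`. -/
def size (x : Finset Node) (u : Node) : ℕ :=
  (x.filter fun w => u <+: w).card

/-- The number of the last child of `u` in `x` (counted from one), and `0` if there is none. -/
noncomputable def numChildren (x : Finset Node) (u : Node) : ℕ :=
  sSup ((fun i => i + 1) '' {i : ℕ | 0 < size x (u ++ [i])})

/-- The list of the sizes `#x(ui)`, for `i` up to the last child of `u` in `x`. -/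
noncomputable def childSizes (x : Finset Node) (u : Node) : List ℕ :=
  (List.range (numChildren x u)).map fun i => size x (u ++ [i])

/-! ### The state space of the limit -/

/-- Finite words, infinite words, and finite words continued by infinitely many symbols `∞`. -/
inductive NodeBar : Type
  | finite (v : List ℕ)
  | infinite (f : ℕ → ℕ)
  | finiteInfty (v : List ℕ)

/-- The prefix relation between nodes and elements of `NodeBar`. -/
def IsPrefix (u : Node) : NodeBar → Prop
  | .finite v => u <+: v
  | .infinite f => (List.range u.length).map f = u
  | .finiteInfty v => u <+: v

/-- The set `A_u` of all elements with prefix `u`. -/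
def cyl (u : Node) : Set NodeBar := {v | IsPrefix u v}

instance : MeasurableSpace NodeBar := MeasurableSpace.generateFrom (Set.range cyl)

/-- Convergence of Harris trees, embedded as the uniform distributions on their node sets, to the
probability measure `μ` in the Doob-Martin topology. This is the coarsest topology that makes all
evaluations `μ ↦ μ (A_u)` continuous, hence convergence means convergence of all evaluations. -/
def TendstoDM (x : ℕ → Finset Node) (μ : ProbabilityMeasure NodeBar) : Prop :=
  ∀ u : Node, Tendsto (fun n => (size (x n) u : ℝ) / ((x n).card : ℝ)) atTop
    (𝓝 ((μ : Measure NodeBar).real (cyl u)))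

/-- The sequence `ρ(μ, u)` of relative weights `μ (A_{ui}) / μ (A_u)`. -/
noncomputable def rho (μ : ProbabilityMeasure NodeBar) (u : Node) : ℕ → ℝ :=
  fun i => (μ : Measure NodeBar).real (cyl (u ++ [i])) / (μ : Measure NodeBar).real (cyl u)

/-- The infinite-dimensional probability simplex. -/
def simplex : Set (ℕ → ℝ) := {s | (∀ i, 0 ≤ s i) ∧ HasSum s 1}

/-! ### The GEM distributions -/

/-- The law of the factor `ζ_i` for the parameter `a = (a_1, …, a_k)`:
`Beta (a_i, 1 + a_{i+1} + ⋯ + a_k)` for `i ≤ k` (the sum is empty for `i = k`), and `Beta (1, 1)`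
for `i > k`. -/
noncomputable def gemFactor (a : List ℕ) (i : ℕ) : Measure ℝ :=
  if h : i < a.length then betaMeasure (a[i] : ℝ) (1 + ((a.drop (i + 1)).sum : ℝ))
  else betaMeasure 1 1

/-- The stick-breaking map `ξ_i = ζ_i ∏_{j < i} (1 - ζ_j)`. -/
noncomputable def stickBreaking (ζ : ℕ → ℝ) : ℕ → ℝ :=
  fun i => ζ i * ∏ j ∈ Finset.range i, (1 - ζ j)

/-- The distribution `GEM (a)`, for a finite sequence `a` of positive integers, as a measure on the
space of real sequences: the law of the stick-breaking sequence with independent factors. -/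
noncomputable def gem (a : List ℕ) : Measure (ℕ → ℝ) :=
  (Measure.infinitePi (gemFactor a)).map stickBreaking

end HarrisChain

/-! The tree is cut by binary splits, one for each pair `(u, i)`. The subtree of `u`, without the
subtrees of the children before `i`, is divided into the subtree of the child `i` (size `l`) and the
rest, namely `u` itself together with the subtrees of its younger children (size `r`). When the
child `i` is born this content is `(1, 1)`. Afterwards a uniformly chosen ancestor increases `l` by
one if it lies in the first part and `r` by one if it lies in the second, since a new child of `u`
is younger than `i`. So each split carries a two-color Pólya urn, observed only when a node arrives
below it.

The urns are independent in the following sense: a product of urn-harmonic functions over finitely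
many splits is harmonic for the whole tree chain (`IsHarris.sum_prod_urnWeight_attach`). The reason
is that all words arriving below a deepest split fall on the same side of every other split
considered. Taking the harmonic functions `urnMoment p q`, which converge to `z ^ p * (1 - z) ^ q`
in the limiting fraction `z`, and letting time tend to infinity in the martingale identity gives all
joint moments of the limiting fractions given `X n = x` (`setIntegral_prod_fraction`). They are
products of beta moments whose parameters are the urn contents at time `n`, and these are exactly
the GEM parameters (`IsHarris.gemFactor_childSizes`). Moments determine a law on a cube, so the
fractions are independent beta variables (`hasLaw_fraction`).

Finally `rho` at `u` is the stick-breaking transform of the fractions at `(u, 0), (u, 1), …`.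
Different nodes use disjoint families of fractions, whence the GEM laws and the independence. The
divisions make sense because all masses are almost surely positive (`ae_mass_pos_restMass_pos`). -/

namespace HarrisChain

/-! ### Combinatorics of Harris trees -/

/-- Finite sets of words that contain the root and are closed under passing to the parent and to
the next elder sibling. -/
structure IsHarris (x : Finset Node) : Prop where
  nil_mem : [] ∈ x
  parent_mem : ∀ u i, u ++ [i] ∈ x → u ∈ x
  sibling_mem : ∀ u i, u ++ [i + 1] ∈ x → u ++ [i] ∈ x

namespace IsHarris

variable {x : Finset Node}

theorem prefix_mem (hx : IsHarris x) {u w : Node} (h : u <+: w) (hw : w ∈ x) : u ∈ x := by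
  obtain ⟨t, rfl⟩ := h
  induction t using List.reverseRecOn with
  | nil => simpa using hw
  | append_singleton t i ih => exact ih (hx.parent_mem _ i (by simpa using hw))

theorem elder_mem (hx : IsHarris x) {u : Node} {i k : ℕ} (h : i ≤ k) (hw : u ++ [k] ∈ x) :
    u ++ [i] ∈ x := by
  induction k, h using Nat.le_induction with
  | base => exact hw
  | succ k _ ih => exact ih (hx.sibling_mem _ _ hw)

theorem singleton : IsHarris {[]} where
  nil_mem := by simp
  parent_mem u i h := by simp at h
  sibling_mem u i h := by simp at h

end IsHarris

theorem exists_child_notMem (x : Finset Node) (u : Node) : ∃ i : ℕ, u ++ [i] ∉ x := by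
  by_contra! h
  refine Set.infinite_of_injective_forall_mem (f := fun i : ℕ => u ++ [i]) ?_ h x.finite_toSet
  intro a b hab
  simpa using hab

/-- The first letter `i` such that `u ++ [i]` does not belong to `x`. -/
noncomputable def nextChild (x : Finset Node) (u : Node) : ℕ :=
  sInf {i | u ++ [i] ∉ x}

theorem nextChild_notMem (x : Finset Node) (u : Node) : u ++ [nextChild x u] ∉ x :=
  Nat.sInf_mem (exists_child_notMem x u)

theorem child_mem_iff {x : Finset Node} (hx : IsHarris x) (u : Node) (i : ℕ) :
    u ++ [i] ∈ x ↔ i < nextChild x u := by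
  constructor
  · intro h
    by_contra! hle
    exact nextChild_notMem x u (hx.elder_mem hle h)
  · intro h
    by_contra hn
    exact absurd (Nat.sInf_le (s := {i | u ++ [i] ∉ x}) hn) (by unfold nextChild at h; omega)

theorem nextChild_eq {x : Finset Node} {u : Node} {c : ℕ} (h : ∀ i, u ++ [i] ∈ x ↔ i < c) :
    nextChild x u = c := by
  have h1 : c ≤ nextChild x u := by
    by_contra! hlt
    exact nextChild_notMem x u ((h _).2 hlt)
  exact le_antisymm (Nat.sInf_le (by simp [h])) h1

/-- The tree obtained from `x` by attaching a new node to the node `w`. -/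
noncomputable def attach (x : Finset Node) (w : Node) : Finset Node :=
  insert (w ++ [nextChild x w]) x

theorem IsHarris.isHarris_attach {x : Finset Node} (hx : IsHarris x) {w : Node} (hw : w ∈ x) :
    IsHarris (attach x w) where
  nil_mem := Finset.mem_insert_of_mem hx.nil_mem
  parent_mem u i h := by
    rcases Finset.mem_insert.1 h with h | h
    · obtain ⟨rfl, -⟩ : u = w ∧ i = _ := by simpa using List.append_inj' h rfl
      exact Finset.mem_insert_of_mem hw
    · exact Finset.mem_insert_of_mem (hx.parent_mem u i h)
  sibling_mem u i h := by
    rcases Finset.mem_insert.1 h with h | h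
    · obtain ⟨rfl, h⟩ : u = w ∧ i + 1 = _ := by simpa using List.append_inj' h rfl
      exact Finset.mem_insert_of_mem ((child_mem_iff hx u i).2 (by omega))
    · exact Finset.mem_insert_of_mem (hx.sibling_mem u i h)

theorem word_succ (j : RecSeq) (k : ℕ) : word j (k + 1) = word j (j k) ++
    [((Finset.range k).filter fun i => (j i : ℕ) = (j k : ℕ)).card] := by
  rw [word]

theorem harrisTree_succ_eq_insert (j : RecSeq) (n : ℕ) :
    harrisTree j (n + 1) = insert (word j n) (harrisTree j n) := by
  simp [harrisTree, Finset.range_add_one, Finset.image_insert]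

theorem harrisTree_one (j : RecSeq) : harrisTree j 1 = {[]} := by
  simp [harrisTree, word]

theorem word_mem_harrisTree (j : RecSeq) {k n : ℕ} (h : k < n) : word j k ∈ harrisTree j n :=
  Finset.mem_image_of_mem _ (Finset.mem_range.2 h)

/-- The three claims need each other in the induction. The last letter of a new word is the number
of earlier children of its ancestor, which by the third claim is the first free letter; so the word
is new and the tree stays closed. Injectivity is what allows children of words to be counted as
children of labels. -/
theorem harrisTree_structure (j : RecSeq) (k : ℕ) :
    Set.InjOn (word j) (Set.Iio (k + 1)) ∧ IsHarris (harrisTree j (k + 1)) ∧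
    ∀ l < k + 1, ∀ t, word j l ++ [t] ∈ harrisTree j (k + 1) ↔
      t < ((Finset.range k).filter fun i => (j i : ℕ) = l).card := by
  induction k with
  | zero =>
    refine ⟨?_, ?_, ?_⟩
    · intro a ha b hb _
      simp at ha hb
      omega
    · rw [zero_add, harrisTree_one]
      exact IsHarris.singleton
    · intro l hl t
      rw [zero_add, harrisTree_one]
      simp
  | succ k ih =>
    obtain ⟨hinj, hH, hch⟩ := ih
    have hjk : (j k : ℕ) < k + 1 := (j k).isLt
    have hword := word_succ j k
    have hnot : word j (k + 1) ∉ harrisTree j (k + 1) := by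
      rw [hword, hch _ hjk]
      exact lt_irrefl _
    have hnext : nextChild (harrisTree j (k + 1)) (word j (j k))
        = ((Finset.range k).filter fun i => (j i : ℕ) = (j k : ℕ)).card :=
      nextChild_eq (hch _ hjk)
    have hatt : harrisTree j (k + 1 + 1) = attach (harrisTree j (k + 1)) (word j (j k)) := by
      rw [harrisTree_succ_eq_insert, attach, hnext, hword]
    have hH' : IsHarris (harrisTree j (k + 1 + 1)) := by
      rw [hatt]
      exact hH.isHarris_attach (word_mem_harrisTree j hjk)
    refine ⟨?_, hH', ?_⟩
    · have hIio : Set.Iio (k + 1 + 1) = insert (k + 1) (Set.Iio (k + 1)) := by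
        ext a
        simp
      rw [hIio, Set.injOn_insert (by simp)]
      refine ⟨hinj, ?_⟩
      rintro ⟨l, hl, hlw⟩
      exact hnot (hlw ▸ word_mem_harrisTree j hl)
    · intro l hl t
      rw [harrisTree_succ_eq_insert, Finset.mem_insert]
      rcases Nat.lt_succ_iff_lt_or_eq.1 hl with hl | rfl
      · rw [hch l hl, Finset.range_add_one, Finset.filter_insert, hword]
        have hiff : word j l ++ [t] = word j (j k) ++
            [((Finset.range k).filter fun i => (j i : ℕ) = (j k : ℕ)).card] ↔
            l = j k ∧ t = ((Finset.range k).filter fun i => (j i : ℕ) = (j k : ℕ)).card := by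
          constructor
          · intro h
            obtain ⟨h1, h2⟩ := List.append_inj' h rfl
            exact ⟨hinj hl hjk h1, by simpa using h2⟩
          · rintro ⟨h1, h2⟩
            rw [h1, h2]
        rw [hiff]
        by_cases hlk : (j k : ℕ) = l
        · subst hlk
          rw [if_pos rfl, Finset.card_insert_of_notMem (by simp)]
          simp
          omega
        · rw [if_neg hlk]
          simp [Ne.symm hlk]
      · have h0 : ((Finset.range (k + 1)).filter fun i => (j i : ℕ) = k + 1) = ∅ := by
          refine Finset.filter_eq_empty_iff.2 fun i hi => ?_
          have := (j i).isLt
          have := Finset.mem_range.1 hi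
          omega
        rw [h0]
        simp only [Finset.card_empty, not_lt_zero, iff_false, not_or]
        refine ⟨fun h => by simp at h, fun h => hnot (hH.parent_mem _ _ h)⟩

theorem isHarris_harrisTree (j : RecSeq) (k : ℕ) : IsHarris (harrisTree j (k + 1)) :=
  (harrisTree_structure j k).2.1

theorem card_harrisTree (j : RecSeq) (n : ℕ) : (harrisTree j n).card = n := by
  cases n with
  | zero => simp [harrisTree]
  | succ k =>
    rw [harrisTree, Finset.card_image_of_injOn, Finset.card_range]
    simpa [Set.Iio] using (harrisTree_structure j k).1

/-- The step depends on the labels only through the word of the chosen ancestor. Together with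
`sum_harrisTree`, averages over labels become averages over the nodes of the tree. -/
theorem harrisTree_succ (j : RecSeq) (k : ℕ) :
    harrisTree j (k + 2) = attach (harrisTree j (k + 1)) (word j (j k)) := by
  rw [harrisTree_succ_eq_insert, attach, nextChild_eq ((harrisTree_structure j k).2.2 _ (j k).isLt),
    word_succ]

theorem sum_harrisTree (j : RecSeq) (k : ℕ) (h : Node → ℝ) :
    ∑ w ∈ harrisTree j (k + 1), h w = ∑ l : Fin (k + 1), h (word j l) := by
  rw [harrisTree, Finset.sum_image, Finset.sum_range]
  intro a ha b hb hab
  exact (harrisTree_structure j k).1 (by simpa using ha) (by simpa using hb) hab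

/-! ### Urn martingales -/

open Classical in
/-- The number of nodes of `x` in the subtrees of the children of `u` after the child `i`. -/
noncomputable def youngerSize (x : Finset Node) (u : Node) (i : ℕ) : ℕ :=
  (x.filter fun w => ∃ t, i < t ∧ u ++ [t] <+: w).card

/-- The number of binary splits that lead from the root to `(u, i)`. -/
def splitDepth (v : Node × ℕ) : ℕ := v.1.length + v.1.sum + v.2

/-- The product over `v ∈ F` of the weights `f v`, evaluated at the content of the urn at
`v = (u, i)`: the size of the subtree of the child `i` of `u`, and the number of the remaining
nodes in the subtree of `u` without the elder siblings of this child. -/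
noncomputable def urnWeight (f : ℕ → ℕ → ℝ) (x : Finset Node) (v : Node × ℕ) : ℝ :=
  if size x (v.1 ++ [v.2]) = 0 then f 1 1
  else f (size x (v.1 ++ [v.2])) (youngerSize x v.1 v.2 + 1)

/-- The functions of the content of a two-color Pólya urn that are harmonic for the urn. -/
def UrnHarmonic (f : ℕ → ℕ → ℝ) : Prop :=
  ∀ l r, 1 ≤ l → 1 ≤ r → l * f (l + 1) r + r * f l (r + 1) = (l + r) * f l r

theorem IsHarris.size_pos_iff {x : Finset Node} (hx : IsHarris x) (u : Node) :
    0 < size x u ↔ u ∈ x := by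
  rw [size, Finset.card_pos]
  constructor
  · rintro ⟨w, hw⟩
    rw [Finset.mem_filter] at hw
    exact hx.prefix_mem hw.2 hw.1
  · intro h
    exact ⟨u, Finset.mem_filter.2 ⟨h, List.prefix_refl u⟩⟩

open Classical in
theorem IsHarris.youngerSize_eq_zero {x : Finset Node} (hx : IsHarris x) {u : Node} {i : ℕ}
    (h : u ++ [i + 1] ∉ x) : youngerSize x u i = 0 := by
  rw [youngerSize, Finset.card_eq_zero, Finset.filter_eq_empty_iff]
  rintro w hw ⟨t, ht, htw⟩
  exact h (hx.elder_mem ht (hx.prefix_mem htw hw))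

open Classical in
theorem size_attach (x : Finset Node) (w u : Node) :
    size (attach x w) u = size x u + if u <+: w ++ [nextChild x w] then 1 else 0 := by
  unfold size attach
  rw [Finset.filter_insert]
  split_ifs with h
  · rw [Finset.card_insert_of_notMem]
    simp [nextChild_notMem]
  · simp

open Classical in
theorem youngerSize_attach (x : Finset Node) (w u : Node) (i : ℕ) :
    youngerSize (attach x w) u i = youngerSize x u i +
      if ∃ t, i < t ∧ u ++ [t] <+: w ++ [nextChild x w] then 1 else 0 := by
  unfold youngerSize attach
  rw [Finset.filter_insert]
  split_ifs with h
  · rw [Finset.card_insert_of_notMem]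
    simp [nextChild_notMem]
  · simp

/-- A node attached to a set without the child `i` of `u` does not change the weight at `(u, i)`. -/
theorem IsHarris.urnWeight_attach_of_size_eq_zero {x : Finset Node} (hx : IsHarris x)
    (f : ℕ → ℕ → ℝ) {v : Node × ℕ} (hv : size x (v.1 ++ [v.2]) = 0) {w : Node} (hw : w ∈ x) :
    urnWeight f (attach x w) v = urnWeight f x v := by
  have hx' := hx.isHarris_attach hw
  have hvx : v.1 ++ [v.2] ∉ x := fun h => ((hx.size_pos_iff _).2 h).ne' hv
  rw [urnWeight, urnWeight, if_pos hv]
  split_ifs with h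
  · rfl
  · have hmem : v.1 ++ [v.2] ∈ attach x w := (hx'.size_pos_iff _).1 (Nat.pos_of_ne_zero h)
    have heq : v.1 ++ [v.2] = w ++ [nextChild x w] := by
      rcases Finset.mem_insert.1 hmem with h | h
      · exact h
      · exact absurd h hvx
    -- A newborn child has no younger siblings, so the urn starts with content `(1, 1)`, which
    -- matches the default value `f 1 1`.
    have hy : youngerSize (attach x w) v.1 v.2 = 0 := by
      refine hx'.youngerSize_eq_zero fun h' => ?_
      rcases Finset.mem_insert.1 h' with h' | h'
      · rw [← heq] at h'
        simp at h'
      · exact hvx (hx.sibling_mem _ _ h')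
    rw [hy, size_attach, hv, heq, if_pos (List.prefix_refl _)]

theorem child_prefix_attach_iff {x : Finset Node} {u w : Node} {i : ℕ}
    (hu : u ++ [i] ∈ x) : u ++ [i] <+: w ++ [nextChild x w] ↔ u ++ [i] <+: w := by
  rw [List.prefix_concat_iff]
  refine or_iff_right fun h => nextChild_notMem x w (h ▸ hu)

/-- Attaching to `u` itself produces a sibling younger than the existing child `i`. Hence `u`
belongs to the second color, which is the origin of the `+ 1` in `urnWeight`. -/
theorem IsHarris.younger_prefix_attach_iff {x : Finset Node} (hx : IsHarris x) {u w : Node} {i : ℕ}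
    (hu : u ++ [i] ∈ x) : (∃ t, i < t ∧ u ++ [t] <+: w ++ [nextChild x w]) ↔
      (w = u ∨ ∃ t, i < t ∧ u ++ [t] <+: w) := by
  constructor
  · rintro ⟨t, ht, h⟩
    rw [List.prefix_concat_iff] at h
    rcases h with h | h
    · exact Or.inl (List.append_inj' h rfl).1.symm
    · exact Or.inr ⟨t, ht, h⟩
  · rintro (rfl | ⟨t, ht, h⟩)
    · exact ⟨_, (child_mem_iff hx w i).1 hu, List.prefix_refl _⟩
    · exact ⟨t, ht, h.trans (List.prefix_append _ _)⟩

/-- All words below the urn at `v₀` are at the same side of an urn that is not below `v₀`. -/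
theorem child_prefix_congr {v v₀ : Node × ℕ} (hne : v ≠ v₀) (hd : splitDepth v ≤ splitDepth v₀)
    {w w' : Node} (hw : ∃ t, v₀.2 ≤ t ∧ v₀.1 ++ [t] <+: w)
    (hw' : ∃ t, v₀.2 ≤ t ∧ v₀.1 ++ [t] <+: w') {s : ℕ} (hs : v.2 ≤ s)
    (h : v.1 ++ [s] <+: w) : ∃ s', v.2 ≤ s' ∧ (s' = v.2 ↔ s = v.2) ∧ v.1 ++ [s'] <+: w' := by
  obtain ⟨u, i⟩ := v
  obtain ⟨u₀, i₀⟩ := v₀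
  obtain ⟨t, ht, htw⟩ := hw
  obtain ⟨t', ht', htw'⟩ := hw'
  simp only [splitDepth] at *
  -- If `u` is shorter, the side is already decided by a letter of `u₀`. If the lengths agree, then
  -- `u = u₀` and `i < i₀`, so both words lie on the younger side. If `u` is longer, it extends `u₀
  -- ++ [t]` with `i₀ ≤ t`, which makes its depth too large.
  rcases lt_trichotomy u.length u₀.length with hlt | heq | hgt
  · refine ⟨s, hs, Iff.rfl, ?_⟩
    have h1 : u₀ <+: w := (List.prefix_append _ _).trans htw
    have h2 : u ++ [s] <+: u₀ := List.prefix_of_prefix_length_le h h1 (by simpa using hlt)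
    exact h2.trans ((List.prefix_append _ _).trans htw')
  · have h1 : u ++ [s] <+: u₀ ++ [t] := List.prefix_of_prefix_length_le h htw (by simp [heq])
    have h2 : u ++ [s] = u₀ ++ [t] := h1.eq_of_length (by simp [heq])
    obtain ⟨rfl, hst⟩ := List.append_inj' h2 rfl
    have hst : s = t := by simpa using hst
    have hi : i ≠ i₀ := fun hi => hne (by rw [hi])
    refine ⟨t', by omega, by omega, htw'⟩
  · have h1 : u₀ ++ [t] <+: u :=
      List.prefix_of_prefix_length_le htw ((List.prefix_append _ _).trans h) (by simpa using hgt)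
    obtain ⟨z, rfl⟩ := h1
    simp at hd
    omega

theorem urnWeight_attach_congr (f : ℕ → ℕ → ℝ) (x : Finset Node) {v v₀ : Node × ℕ} (hne : v ≠ v₀)
    (hd : splitDepth v ≤ splitDepth v₀) {w w' : Node}
    (hw : ∃ t, v₀.2 ≤ t ∧ v₀.1 ++ [t] <+: w ++ [nextChild x w])
    (hw' : ∃ t, v₀.2 ≤ t ∧ v₀.1 ++ [t] <+: w' ++ [nextChild x w']) :
    urnWeight f (attach x w) v = urnWeight f (attach x w') v := by
  classical
  have key : ∀ {a b : Node}, (∃ t, v₀.2 ≤ t ∧ v₀.1 ++ [t] <+: a) →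
      (∃ t, v₀.2 ≤ t ∧ v₀.1 ++ [t] <+: b) → v.1 ++ [v.2] <+: a → v.1 ++ [v.2] <+: b := by
    intro a b ha hb h
    obtain ⟨s', -, h1, h2⟩ := child_prefix_congr hne hd ha hb le_rfl h
    rwa [h1.2 rfl] at h2
  have key' : ∀ {a b : Node}, (∃ t, v₀.2 ≤ t ∧ v₀.1 ++ [t] <+: a) →
      (∃ t, v₀.2 ≤ t ∧ v₀.1 ++ [t] <+: b) → (∃ t, v.2 < t ∧ v.1 ++ [t] <+: a) →
      ∃ t, v.2 < t ∧ v.1 ++ [t] <+: b := by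
    rintro a b ha hb ⟨t, ht, h⟩
    obtain ⟨s', h0, h1, h2⟩ := child_prefix_congr hne hd ha hb ht.le h
    refine ⟨s', lt_of_le_of_ne h0 fun h => ht.ne' (h1.1 h.symm), h2⟩
  have h1 : size (attach x w) (v.1 ++ [v.2]) = size (attach x w') (v.1 ++ [v.2]) := by
    rw [size_attach, size_attach]
    congr 1
    exact if_congr ⟨key hw hw', key hw' hw⟩ rfl rfl
  have h2 : youngerSize (attach x w) v.1 v.2 = youngerSize (attach x w') v.1 v.2 := by
    rw [youngerSize_attach, youngerSize_attach]
    congr 1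
    exact if_congr ⟨key' hw hw', key' hw' hw⟩ rfl rfl
  rw [urnWeight, urnWeight, h1, h2]

open Classical in
/-- A single urn: the sum of the increments of its weight over all possible new nodes vanishes,
also in the presence of a factor that is constant on the set of new nodes below the urn. -/
theorem IsHarris.sum_urnWeight_attach {x : Finset Node} (hx : IsHarris x) {f : ℕ → ℕ → ℝ}
    (hf : UrnHarmonic f) (v : Node × ℕ) (H : Node → ℝ)
    (hH : ∀ w w', (∃ t, v.2 ≤ t ∧ v.1 ++ [t] <+: w ++ [nextChild x w]) →
      (∃ t, v.2 ≤ t ∧ v.1 ++ [t] <+: w' ++ [nextChild x w']) → H w = H w') :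
    ∑ w ∈ x, urnWeight f (attach x w) v * H w = urnWeight f x v * ∑ w ∈ x, H w := by
  obtain ⟨u, i⟩ := v
  by_cases hv : size x (u ++ [i]) = 0
  · rw [Finset.mul_sum]
    refine Finset.sum_congr rfl fun w hw => ?_
    rw [hx.urnWeight_attach_of_size_eq_zero f hv hw]
  · have hui : u ++ [i] ∈ x := (hx.size_pos_iff _).1 (Nat.pos_of_ne_zero hv)
    have hu : u ∈ x := hx.parent_mem _ _ hui
    set l := size x (u ++ [i]) with hl
    set r := youngerSize x u i + 1 with hr
    -- The node `u` serves as reference point: its next child lies below the urn, so `H u` is the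
    -- constant value of `H` on both colors.
    have hw₀ : ∀ w, (u ++ [i] <+: w ∨ w = u ∨ ∃ t, i < t ∧ u ++ [t] <+: w) → H w = H u := by
      intro w hw
      refine hH _ _ ?_ ⟨_, ((child_mem_iff hx u i).1 hui).le, List.prefix_refl _⟩
      rcases hw with hw | rfl | ⟨t, ht, hw⟩
      · exact ⟨i, le_rfl, hw.trans (List.prefix_append _ _)⟩
      · exact ⟨_, ((child_mem_iff hx w i).1 hui).le, List.prefix_refl _⟩
      · exact ⟨t, ht.le, hw.trans (List.prefix_append _ _)⟩
    have hval : ∀ w ∈ x, urnWeight f (attach x w) (u, i) * H w = f l r * H w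
        + (if u ++ [i] <+: w then (f (l + 1) r - f l r) * H u else 0)
        + (if w = u ∨ ∃ t, i < t ∧ u ++ [t] <+: w then (f l (r + 1) - f l r) * H u else 0) := by
      intro w hw
      simp only [urnWeight, size_attach, youngerSize_attach,
        child_prefix_attach_iff hui, hx.younger_prefix_attach_iff hui, ← hl]
      by_cases h1 : u ++ [i] <+: w
      · have h2 : ¬ (w = u ∨ ∃ t, i < t ∧ u ++ [t] <+: w) := by
          rintro (rfl | ⟨t, ht, h⟩)
          · have := h1.length_le
            simp at this
          · have h3 : u ++ [i] = u ++ [t] :=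
              (List.prefix_of_prefix_length_le h1 h (by simp)).eq_of_length (by simp)
            simp at h3
            omega
        rw [if_pos h1, if_pos h1, if_neg h2, if_neg h2, if_neg (by omega), hw₀ w (Or.inl h1)]
        rw [add_zero, ← hr]
        ring
      · by_cases h2 : w = u ∨ ∃ t, i < t ∧ u ++ [t] <+: w
        · rw [if_neg h1, if_neg h1, if_pos h2, if_pos h2, if_neg (by omega), hw₀ w (Or.inr h2)]
          rw [add_zero, add_right_comm, ← hr]
          ring
        · rw [if_neg h1, if_neg h1, if_neg h2, if_neg h2, if_neg (by omega)]
          simp [hr]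
    have hcl : (x.filter fun w => u ++ [i] <+: w).card = l := by rw [hl, size]
    have hcr : (x.filter fun w => w = u ∨ ∃ t, i < t ∧ u ++ [t] <+: w).card = r := by
      rw [Finset.filter_or, Finset.filter_eq' x u, if_pos hu, Finset.card_union_of_disjoint]
      · rw [hr, youngerSize, Finset.card_singleton, add_comm]
      · rw [Finset.disjoint_singleton_left, Finset.mem_filter]
        rintro ⟨-, t, -, h⟩
        have := h.length_le
        simp at this
    rw [Finset.sum_congr rfl hval, Finset.sum_add_distrib, Finset.sum_add_distrib,
      ← Finset.sum_filter, ← Finset.sum_filter, Finset.sum_const, Finset.sum_const, hcl, hcr,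
      ← Finset.mul_sum]
    have hfw : urnWeight f x (u, i) = f l r := by
      simp only [urnWeight]
      rw [← hl, if_neg hv]
    rw [hfw, nsmul_eq_mul, nsmul_eq_mul]
    have := hf l r (by omega) (by omega)
    -- There are `l` ancestors of the first color and `r` of the second, so the increments cancel by
    -- harmonicity of `f`.
    linear_combination H u * this

/-- Urns are removed in order of decreasing `splitDepth`. The product of the remaining weights does
not distinguish between new nodes below the deepest urn, so it can play the role of the factor `H`
in the one-urn identity. -/
theorem IsHarris.sum_prod_urnWeight_attach {x : Finset Node} (hx : IsHarris x)
    (F : Finset (Node × ℕ)) (f : Node × ℕ → ℕ → ℕ → ℝ) (hf : ∀ v ∈ F, UrnHarmonic (f v)) :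
    ∑ w ∈ x, ∏ v ∈ F, urnWeight (f v) (attach x w) v
      = x.card * ∏ v ∈ F, urnWeight (f v) x v := by
  classical
  induction F using Finset.induction_on_max_value splitDepth with
  | empty => simp
  | insert v₀ F hv₀ hmax ih =>
    simp only [Finset.prod_insert hv₀]
    rw [hx.sum_urnWeight_attach (hf _ (Finset.mem_insert_self _ _)),
      ih fun v hv => hf v (Finset.mem_insert_of_mem hv)]
    · ring
    · intro w w' hw hw'
      exact Finset.prod_congr rfl fun v hv =>
        urnWeight_attach_congr _ x (fun h : v = v₀ => hv₀ (h ▸ hv)) (hmax v hv) hw hw'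

/-! ### One step of the random recursive tree -/

/-- A function of the first `k` ancestors factors through a finite space, where measurability and
boundedness are automatic. -/
theorem exists_eq_comp_restrict {k : ℕ} {Y : RecSeq → ℝ}
    (hY : ∀ j j' : RecSeq, (∀ i < k, j i = j' i) → Y j = Y j') :
    ∃ φ : (∀ i : Finset.range k, Fin ((i : ℕ) + 1)) → ℝ,
      Y = φ ∘ (Finset.range k).restrict := by
  refine ⟨fun f => Y fun i => if h : i ∈ Finset.range k then f ⟨i, h⟩ else 0, ?_⟩
  funext j
  refine hY _ _ fun i hi => ?_
  simp [hi]

theorem integrable_of_forall_lt {k : ℕ} {Y : RecSeq → ℝ}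
    (hY : ∀ j j' : RecSeq, (∀ i < k, j i = j' i) → Y j = Y j') : Integrable Y rrtLaw := by
  obtain ⟨φ, rfl⟩ := exists_eq_comp_restrict hY
  obtain ⟨C, hC⟩ := (Set.finite_range fun f => ‖φ f‖).bddAbove
  refine Integrable.of_bound (C := C) ?_ (ae_of_all _ fun j => hC ⟨_, rfl⟩)
  exact ((measurable_of_countable φ).comp (Finset.measurable_restrict _)).aestronglyMeasurable

theorem integral_indicator_ancestor {k : ℕ} (l : Fin (k + 1)) {Y : RecSeq → ℝ}
    (hY : ∀ j j' : RecSeq, (∀ i < k, j i = j' i) → Y j = Y j') :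
    ∫ j, (if j k = l then 1 else 0) * Y j ∂rrtLaw = ((k : ℝ) + 1)⁻¹ * ∫ j, Y j ∂rrtLaw := by
  obtain ⟨φ, rfl⟩ := exists_eq_comp_restrict hY
  have hind : iIndepFun (fun (i : ℕ) (j : RecSeq) => j i) rrtLaw :=
    iIndepFun_infinitePi (X := fun i x => x) (fun i => measurable_id)
  have h2 := hind.indepFun_finset {k} (Finset.range k) (by simp)
    (fun i => measurable_pi_apply i)
  have h3 := h2.comp (φ := fun f : (∀ i : ({k} : Finset ℕ), Fin ((i : ℕ) + 1)) =>
      if f ⟨k, Finset.mem_singleton_self k⟩ = l then (1 : ℝ) else 0)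
    (ψ := φ) (measurable_of_countable _) (measurable_of_countable _)
  have h4 : (fun j : RecSeq => (if j k = l then (1 : ℝ) else 0))
      = Set.indicator ((fun j : RecSeq => j k) ⁻¹' {l}) 1 := by
    funext j
    simp [Set.indicator]
  have hms : MeasurableSet ((fun j : RecSeq => j k) ⁻¹' {l}) :=
    measurable_pi_apply k (measurableSet_singleton l)
  have h5 : ∫ j, (if j k = l then (1 : ℝ) else 0) ∂rrtLaw = ((k : ℝ) + 1)⁻¹ := by
    rw [h4, integral_indicator_one hms]
    rw [← map_measureReal_apply (measurable_pi_apply k) (measurableSet_singleton l),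
      rrtLaw, Measure.infinitePi_map_eval, measureReal_def,
      PMF.toMeasure_apply_singleton _ _ (measurableSet_singleton l)]
    simp [ENNReal.toReal_add]
  rw [← h5]
  refine h3.integral_fun_mul_eq_mul_integral ?_ ?_
  · exact ((measurable_of_countable _).comp
      (measurable_pi_lambda _ fun i => measurable_pi_apply _)).aestronglyMeasurable
  · exact ((measurable_of_countable φ).comp (Finset.measurable_restrict _)).aestronglyMeasurable

/-- The direct ancestor of the node `k + 1` is uniform given the tree with `k + 1` nodes. -/
theorem integral_ancestor {k : ℕ} {Y : RecSeq → Fin (k + 1) → ℝ}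
    (hY : ∀ l, ∀ j j' : RecSeq, (∀ i < k, j i = j' i) → Y j l = Y j' l) :
    ∫ j, Y j (j k) ∂rrtLaw = ∫ j, ((k : ℝ) + 1)⁻¹ * ∑ l, Y j l ∂rrtLaw := by
  have h1 : ∀ j : RecSeq, Y j (j k) = ∑ l, (if j k = l then 1 else 0) * Y j l := by
    intro j
    simp
  simp_rw [h1]
  rw [integral_const_mul, integral_finsetSum, integral_finsetSum, Finset.mul_sum]
  · exact Finset.sum_congr rfl fun l _ => integral_indicator_ancestor l (hY l)
  · exact fun l _ => integrable_of_forall_lt (hY l)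
  · refine fun l _ => integrable_of_forall_lt (k := k + 1) fun j j' h => ?_
    rw [h k (Nat.lt_succ_self k), hY l j j' fun i hi => h i (hi.trans (Nat.lt_succ_self k))]

theorem harrisTree_congr {j j' : RecSeq} {k n : ℕ} (hn : n ≤ k + 1) (h : ∀ i < k, j i = j' i) :
    harrisTree j n = harrisTree j' n := by
  refine Finset.image_congr fun l hl => word_congr l fun i hi => h i ?_
  have := Finset.mem_range.1 hl
  omega

/-- The functions of the tree that are harmonic for the Harris chain. -/
def TreeHarmonic (g : Finset Node → ℝ) : Prop :=
  ∀ x, IsHarris x → ∑ w ∈ x, g (attach x w) = x.card * g x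

/-- The martingale property, tested on the event that the tree at time `n` is `x`. For `n ≤ k + 1`
this event depends on the first `k` ancestors only, hence not on the choice of the next one. -/
theorem TreeHarmonic.integral_step {g : Finset Node → ℝ} (hg : TreeHarmonic g)
    {k n : ℕ} (hn : n ≤ k + 1) (x : Finset Node) :
    ∫ j, (if harrisTree j n = x then 1 else 0) * g (harrisTree j (k + 2)) ∂rrtLaw
      = ∫ j, (if harrisTree j n = x then 1 else 0) * g (harrisTree j (k + 1)) ∂rrtLaw := by
  simp_rw [harrisTree_succ]
  rw [integral_ancestor (Y := fun j l => (if harrisTree j n = x then 1 else 0) *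
    g (attach (harrisTree j (k + 1)) (word j l)))]
  · congr 1
    funext j
    rw [← Finset.mul_sum, ← sum_harrisTree j k (fun w => g (attach (harrisTree j (k + 1)) w)),
      hg _ (isHarris_harrisTree j k), card_harrisTree]
    push_cast
    field_simp
  · intro l j j' h
    rw [harrisTree_congr hn h, harrisTree_congr le_rfl h,
      word_congr l fun i hi => h i (by omega)]

theorem TreeHarmonic.integral_rrtLaw {g : Finset Node → ℝ} (hg : TreeHarmonic g)
    {n m : ℕ} (hn : 1 ≤ n) (hm : n ≤ m) (x : Finset Node) :
    ∫ j, (if harrisTree j n = x then 1 else 0) * g (harrisTree j m) ∂rrtLaw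
      = rrtLaw.real {j | harrisTree j n = x} * g x := by
  induction m, hm using Nat.le_induction with
  | base =>
    have h : ∀ j : RecSeq, (if harrisTree j n = x then 1 else 0) * g (harrisTree j n)
        = Set.indicator {j : RecSeq | harrisTree j n = x} 1 j * g x := by
      intro j
      by_cases hj : harrisTree j n = x <;> simp [hj]
    simp_rw [h]
    rw [integral_mul_const, integral_indicator_one]
    exact ((measurable_pi_apply n).comp measurable_harrisTree) (measurableSet_singleton x)
  | succ m hm ih =>
    obtain ⟨k, rfl⟩ : ∃ k, m = k + 1 := ⟨m - 1, by omega⟩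
    rw [← ih]
    exact hg.integral_step hm x

/-- The Harris chain on an arbitrary probability space. -/
theorem TreeHarmonic.setIntegral_eq {Ω : Type*} [MeasurableSpace Ω] {P : Measure Ω}
    [IsProbabilityMeasure P] {X : ℕ → Ω → Finset Node}
    (hX : HasLaw (fun ω n => X n ω) harrisLaw P)
    {g : Finset Node → ℝ} (hg : TreeHarmonic g)
    {n m : ℕ} (hn : 1 ≤ n) (hm : n ≤ m) (x : Finset Node) :
    ∫ ω in X n ⁻¹' {x}, g (X m ω) ∂P = P.real (X n ⁻¹' {x}) * g x := by
  have hXn : AEMeasurable (X n) P := (measurable_pi_apply n).comp_aemeasurable hX.aemeasurable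
  have hnull : NullMeasurableSet (X n ⁻¹' {x}) P :=
    hXn.nullMeasurableSet_preimage (measurableSet_singleton x)
  have hmeas : Measurable fun y : ℕ → Finset Node => (if y n = x then (1 : ℝ) else 0) * g (y m) :=
    ((measurable_of_countable fun z : Finset Node => if z = x then (1 : ℝ) else 0).comp
      (measurable_pi_apply n)).mul ((measurable_of_countable g).comp (measurable_pi_apply m))
  have h1 : ∫ ω in X n ⁻¹' {x}, g (X m ω) ∂P
      = ∫ ω, (if X n ω = x then 1 else 0) * g (X m ω) ∂P := by
    rw [← integral_indicator₀ hnull]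
    congr 1
    funext ω
    by_cases h : X n ω = x <;> simp [h]
  have h2 := hX.integral_comp (f := fun y => (if y n = x then (1 : ℝ) else 0) * g (y m))
    hmeas.aestronglyMeasurable
  have hms : MeasurableSet ((fun y : ℕ → Finset Node => y n) ⁻¹' {x}) :=
    measurable_pi_apply n (measurableSet_singleton x)
  have h3 : P.real (X n ⁻¹' {x}) = rrtLaw.real {j | harrisTree j n = x} := by
    have h4 := hX.measureReal_eq (p := fun y => y n = x) hms
    exact h4.trans (map_measureReal_apply measurable_harrisTree hms)
  rw [h1, h3, ← hg.integral_rrtLaw hn hm x]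
  refine h2.trans ?_
  rw [harrisLaw, integral_map measurable_harrisTree.aemeasurable hmeas.aestronglyMeasurable]

theorem ae_isHarris {Ω : Type*} [MeasurableSpace Ω] {P : Measure Ω}
    {X : ℕ → Ω → Finset Node} (hX : HasLaw (fun ω n => X n ω) harrisLaw P) :
    ∀ᵐ ω ∂P, ∀ k, X 1 ω = {[]} ∧ IsHarris (X (k + 1) ω) ∧ (X (k + 1) ω).card = k + 1 := by
  rw [ae_all_iff]
  intro k
  have hmeas : MeasurableSet ((fun y : ℕ → Finset Node => (y 1, y (k + 1))) ⁻¹'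
      {z | z.1 = {[]} ∧ IsHarris z.2 ∧ z.2.card = k + 1}) :=
    ((measurable_pi_apply 1).prodMk (measurable_pi_apply (k + 1)))
      (Set.to_countable _).measurableSet
  have h : ∀ᵐ y ∂harrisLaw, y 1 = {[]} ∧ IsHarris (y (k + 1)) ∧ (y (k + 1)).card = k + 1 := by
    refine (ae_map_iff measurable_harrisTree.aemeasurable hmeas).2 ?_
    exact ae_of_all _ fun j => ⟨harrisTree_one j, isHarris_harrisTree j k, card_harrisTree j _⟩
  rw [← hX.map_eq] at h
  exact ae_of_ae_map hX.aemeasurable h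

theorem treeHarmonic_prod_urnWeight (F : Finset (Node × ℕ)) (f : Node × ℕ → ℕ → ℕ → ℝ)
    (hf : ∀ v ∈ F, UrnHarmonic (f v)) : TreeHarmonic fun x => ∏ v ∈ F, urnWeight (f v) x v :=
  fun _ hx => hx.sum_prod_urnWeight_attach F f hf

/-! ### Pólya urns and beta distributions -/

/-- The moment `E[Z ^ p * (1 - Z) ^ q]` of the limit `Z` of the proportion of the first color, for
a Pólya urn with initial content `(l, r)`. -/
noncomputable def urnMoment (p q l r : ℕ) : ℝ :=
  (l.ascFactorial p * r.ascFactorial q : ℕ) / ((l + r).ascFactorial (p + q) : ℕ)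

theorem ascFactorial_pos {n : ℕ} (hn : 1 ≤ n) (k : ℕ) : 0 < n.ascFactorial k := by
  induction k with
  | zero => simp
  | succ k ih =>
    rw [Nat.ascFactorial_succ]
    positivity

/-- By `n * (n + 1).ascFactorial p = (n + p) * n.ascFactorial p`, the two terms contribute the
factors `l + p` and `r + q`; their sum is the factor that the denominator calls for. -/
theorem urnHarmonic_urnMoment (p q : ℕ) : UrnHarmonic (urnMoment p q) := by
  intro l r hl hr
  have hlr : 1 ≤ l + r := by omega
  have h0 := ascFactorial_pos hlr (p + q)
  have h0' := ascFactorial_pos (n := l + r + 1) (by omega) (p + q)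
  have h1 : (l * (l + 1).ascFactorial p : ℝ) = (l + p) * l.ascFactorial p := by
    exact_mod_cast Nat.succ_ascFactorial l p
  have h2 : (r * (r + 1).ascFactorial q : ℝ) = (r + q) * r.ascFactorial q := by
    exact_mod_cast Nat.succ_ascFactorial r q
  have h3 : ((l + r : ℝ) * (l + r + 1).ascFactorial (p + q))
      = (l + r + (p + q)) * (l + r).ascFactorial (p + q) := by
    exact_mod_cast Nat.succ_ascFactorial (l + r) (p + q)
  have e1 : l + 1 + r = l + r + 1 := by ring
  have e2 : l + (r + 1) = l + r + 1 := by ring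
  simp only [urnMoment, e1, e2]
  push_cast
  have h0r : (0 : ℝ) < (l + r).ascFactorial (p + q) := by exact_mod_cast h0
  have h0r' : (0 : ℝ) < (l + r + 1).ascFactorial (p + q) := by exact_mod_cast h0'
  field_simp
  linear_combination (((l + r).ascFactorial (p + q) : ℕ) : ℝ) * (r.ascFactorial q * h1)
    + (((l + r).ascFactorial (p + q) : ℕ) : ℝ) * (l.ascFactorial p * h2)
    - (l.ascFactorial p : ℝ) * r.ascFactorial q * h3

theorem urnMoment_nonneg (p q l r : ℕ) : 0 ≤ urnMoment p q l r := by
  unfold urnMoment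
  positivity

theorem ascFactorial_mono {m n : ℕ} (h : m ≤ n) (k : ℕ) : m.ascFactorial k ≤ n.ascFactorial k := by
  induction k with
  | zero => simp
  | succ k ih =>
    rw [Nat.ascFactorial_succ, Nat.ascFactorial_succ]
    gcongr

theorem urnMoment_le_one (p q l r : ℕ) : urnMoment p q l r ≤ 1 := by
  refine div_le_one_of_le₀ ?_ (by positivity)
  norm_cast
  rw [← Nat.ascFactorial_mul_ascFactorial]
  exact Nat.mul_le_mul (ascFactorial_mono (by omega) _) (ascFactorial_mono (by omega) _)

theorem tendsto_ascFactorial_div {L : ℕ → ℕ} {z : ℝ}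
    (h : Tendsto (fun m : ℕ => (L m : ℝ) / m) atTop (𝓝 z)) (p : ℕ) :
    Tendsto (fun m : ℕ => ((L m).ascFactorial p : ℝ) / (m : ℝ) ^ p) atTop (𝓝 (z ^ p)) := by
  induction p with
  | zero => simp
  | succ p ih =>
    have h1 : Tendsto (fun m : ℕ => (p : ℝ) / m) atTop (𝓝 0) :=
      tendsto_const_div_atTop_nhds_zero_nat _
    have h2 := (h.add h1).mul ih
    rw [add_zero, ← pow_succ'] at h2
    refine h2.congr fun m => ?_
    rw [Nat.ascFactorial_succ, pow_succ']
    push_cast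
    rw [← add_div, div_mul_div_comm]

/-- Rising factorials of quantities of order `m` behave like powers, and the powers of `m` cancel.
-/
theorem tendsto_urnMoment {L R : ℕ → ℕ} {a b : ℝ} (hab : a + b ≠ 0)
    (hL : Tendsto (fun m : ℕ => (L m : ℝ) / m) atTop (𝓝 a))
    (hR : Tendsto (fun m : ℕ => (R m : ℝ) / m) atTop (𝓝 b)) (p q : ℕ) :
    Tendsto (fun m => urnMoment p q (L m) (R m)) atTop
      (𝓝 ((a / (a + b)) ^ p * (b / (a + b)) ^ q)) := by
  have hLR : Tendsto (fun m : ℕ => ((L m + R m : ℕ) : ℝ) / m) atTop (𝓝 (a + b)) := by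
    refine (hL.add hR).congr fun m => ?_
    push_cast
    rw [add_div]
  have h := ((tendsto_ascFactorial_div hL p).mul (tendsto_ascFactorial_div hR q)).div
    (tendsto_ascFactorial_div hLR (p + q)) (pow_ne_zero _ hab)
  have e : a ^ p * b ^ q / (a + b) ^ (p + q) = (a / (a + b)) ^ p * (b / (a + b)) ^ q := by
    rw [div_pow, div_pow, div_mul_div_comm, pow_add]
  rw [← e]
  refine h.congr' ?_
  filter_upwards [eventually_ge_atTop 1] with m hm
  have hm' : (m : ℝ) ≠ 0 := by positivity
  simp only [Pi.div_apply, urnMoment]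
  push_cast
  rw [div_mul_div_comm, ← pow_add, div_div_div_cancel_right₀ (pow_ne_zero _ hm')]

theorem urnMoment_one_one_left (p : ℕ) : urnMoment p 0 1 1 = ((p : ℝ) + 1)⁻¹ := by
  have h : (1 + 1 : ℕ).ascFactorial (p + 0) = (p + 1) * p.factorial := by
    have := Nat.succ_ascFactorial 1 p
    rw [one_mul, Nat.one_ascFactorial] at this
    rw [add_zero, add_comm p 1]
    exact this
  unfold urnMoment
  rw [h]
  have : (p.factorial : ℝ) ≠ 0 := by positivity
  simp only [Nat.one_ascFactorial, Nat.ascFactorial_zero]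
  push_cast
  field_simp

theorem urnMoment_one_one_right (q : ℕ) : urnMoment 0 q 1 1 = ((q : ℝ) + 1)⁻¹ := by
  rw [← urnMoment_one_one_left]
  unfold urnMoment
  rw [mul_comm, add_comm 0 q]

theorem beta_add_one {a b : ℝ} (ha : 0 < a) (hb : 0 < b) :
    beta (a + 1) b = a / (a + b) * beta a b := by
  have hab : 0 < a + b := add_pos ha hb
  have := Real.Gamma_pos_of_pos hab
  rw [beta, beta, Real.Gamma_add_one ha.ne', add_right_comm, Real.Gamma_add_one hab.ne']
  field_simp

theorem betaPDFReal_nonneg {a b : ℝ} (ha : 0 < a) (hb : 0 < b) (x : ℝ) : 0 ≤ betaPDFReal a b x := by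
  by_cases h : 0 < x ∧ x < 1
  · exact (betaPDFReal_pos h.1 h.2 ha hb).le
  · rw [betaPDFReal, if_neg h]

theorem integral_betaMeasure {a b : ℝ} (ha : 0 < a) (hb : 0 < b) (g : ℝ → ℝ) :
    ∫ x, g x ∂betaMeasure a b = ∫ x, betaPDFReal a b x * g x := by
  rw [betaMeasure, integral_withDensity_eq_integral_toReal_smul]
  · refine integral_congr_ae (ae_of_all _ fun x => ?_)
    simp only [betaPDF, ENNReal.toReal_ofReal (betaPDFReal_nonneg ha hb x), smul_eq_mul]
  · exact (measurable_betaPDFReal a b).ennreal_ofReal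
  · exact ae_of_all _ fun x => ENNReal.ofReal_lt_top

/-- Multiplying the density of Beta `(a, b)` by `x` gives a multiple of the density of Beta `(a + 1,
b)`. -/
theorem integral_pow_betaMeasure (p : ℕ) {a b : ℝ} (ha : 0 < a) (hb : 0 < b) :
    ∫ x, x ^ (p + 1) ∂betaMeasure a b = a / (a + b) * ∫ x, x ^ p ∂betaMeasure (a + 1) b := by
  rw [integral_betaMeasure ha hb, integral_betaMeasure (by linarith) hb, ← integral_const_mul]
  congr 1
  funext x
  unfold betaPDFReal
  split_ifs with h
  · have hbeta := beta_pos ha hb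
    have hab : 0 < a + b := add_pos ha hb
    have hx : x ^ (a + 1 - 1) = x ^ (a - 1) * x := by
      rw [← Real.rpow_add_one h.1.ne']
      ring_nf
    rw [beta_add_one ha hb, hx]
    field_simp
    ring
  · simp

theorem integral_pow_betaMeasure_eq_urnMoment (p : ℕ) {l r : ℕ} (hl : 1 ≤ l) (hr : 1 ≤ r) :
    ∫ x, x ^ p ∂betaMeasure (l : ℝ) (r : ℝ) = urnMoment p 0 l r := by
  have hr' : (0 : ℝ) < r := by exact_mod_cast hr
  induction p generalizing l with
  | zero =>
    have := isProbabilityMeasureBeta (α := (l : ℝ)) (β := (r : ℝ)) (by exact_mod_cast hl) hr'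
    simp [urnMoment]
  | succ p ih =>
    have hl' : (0 : ℝ) < l := by exact_mod_cast hl
    have := ih (l := l + 1) (by omega)
    push_cast at this
    rw [integral_pow_betaMeasure p hl' hr', this]
    have h1 := Nat.succ_ascFactorial l p
    have h2 := Nat.succ_ascFactorial (l + r) p
    unfold urnMoment
    rw [Nat.ascFactorial_succ, Nat.ascFactorial_zero, mul_one, mul_one, add_zero, add_zero,
      Nat.ascFactorial_succ, ← h1, ← h2, Nat.add_right_comm]
    push_cast
    rw [div_mul_div_comm]

theorem ae_mem_Icc_betaMeasure (a b : ℝ) : ∀ᵐ x ∂betaMeasure a b, x ∈ Set.Icc (0 : ℝ) 1 := by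
  refine (ae_withDensity_iff (measurable_betaPDFReal a b).ennreal_ofReal).2 ?_
  refine ae_of_all _ fun x hx => ⟨?_, ?_⟩
  · by_contra! h
    exact hx (betaPDF_eq_zero_of_nonpos h.le)
  · by_contra! h
    exact hx (betaPDF_eq_zero_of_one_le h.le)

/-! ### The moment problem on a cube -/

/-- The coordinates generate an algebra of bounded continuous functions that separates points, hence
determines finite measures; this algebra is the linear span of the monomials. -/
theorem ext_of_integral_prod_pow_unitInterval {ι : Type*} [Countable ι]
    {μ ν : Measure (ι → unitInterval)} [IsFiniteMeasure μ] [IsFiniteMeasure ν]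
    (h : ∀ p : ι →₀ ℕ, ∫ z, ∏ i ∈ p.support, (z i : ℝ) ^ p i ∂μ
      = ∫ z, ∏ i ∈ p.support, (z i : ℝ) ^ p i ∂ν) : μ = ν := by
  let c : ι → BoundedContinuousFunction (ι → unitInterval) ℝ := fun i =>
    BoundedContinuousFunction.mkOfCompact
      ⟨fun z => (z i : ℝ), continuous_subtype_val.comp (continuous_apply i)⟩
  have hc : ∀ i z, c i z = (z i : ℝ) := fun i z => rfl
  let A : StarSubalgebra ℝ (BoundedContinuousFunction (ι → unitInterval) ℝ) :=
    { Algebra.adjoin ℝ (Set.range c) with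
      star_mem' := fun {a} ha => by
        have hstar : star a = a := by
          ext z
          simp
        rwa [hstar] }
  refine ext_of_forall_mem_subalgebra_integral_eq_of_polish (𝕜 := ℝ) (A := A) ?_ ?_
  · intro x y hxy
    obtain ⟨i, hi⟩ := Function.ne_iff.1 hxy
    refine ⟨fun z => (z i : ℝ), ?_, fun h => hi (Subtype.ext h)⟩
    refine ⟨_, ⟨c i, Algebra.subset_adjoin ⟨i, rfl⟩, rfl⟩, rfl⟩
  · intro g hg
    have hg' : g ∈ Algebra.adjoin ℝ (Set.range c) := hg
    rw [← Subalgebra.mem_toSubmodule, Algebra.adjoin_eq_span] at hg'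
    clear hg
    induction hg' using Submodule.span_induction with
    | mem g hg =>
      obtain ⟨p, rfl⟩ := (Submonoid.mem_closure_range_iff).1 hg
      have := h p
      simpa [Finsupp.prod, hc] using this
    | zero => simp
    | add g₁ g₂ _ _ h₁ h₂ =>
      simp only [BoundedContinuousFunction.coe_add, Pi.add_apply]
      rw [integral_add (g₁.integrable μ) (g₂.integrable μ),
        integral_add (g₁.integrable ν) (g₂.integrable ν), h₁, h₂]
    | smul a g _ h₁ =>
      simp only [BoundedContinuousFunction.coe_smul, smul_eq_mul]
      rw [integral_const_mul, integral_const_mul, h₁]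

/-- Both measures live on the cube, so clamping the coordinates to `[0, 1]` changes nothing almost
everywhere and reduces the claim to the compact case. -/
theorem ext_of_integral_prod_pow {ι : Type*} [Countable ι]
    {μ ν : Measure (ι → ℝ)} [IsFiniteMeasure μ] [IsFiniteMeasure ν]
    (hμ : ∀ᵐ z ∂μ, ∀ i, z i ∈ Set.Icc (0 : ℝ) 1) (hν : ∀ᵐ z ∂ν, ∀ i, z i ∈ Set.Icc (0 : ℝ) 1)
    (h : ∀ p : ι →₀ ℕ, ∫ z, ∏ i ∈ p.support, z i ^ p i ∂μ
      = ∫ z, ∏ i ∈ p.support, z i ^ p i ∂ν) : μ = ν := by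
  let c : (ι → ℝ) → ι → unitInterval := fun z i => Set.projIcc 0 1 zero_le_one (z i)
  let e : (ι → unitInterval) → ι → ℝ := fun z i => z i
  have hcm : Measurable c := measurable_pi_lambda _ fun i =>
    (continuous_projIcc.measurable).comp (measurable_pi_apply i)
  have hem : Measurable e := measurable_pi_lambda _ fun i =>
    measurable_subtype_coe.comp (measurable_pi_apply i)
  have hce : ∀ z : ι → ℝ, (∀ i, z i ∈ Set.Icc (0 : ℝ) 1) → e (c z) = z := by
    intro z hz
    funext i
    exact congrArg Subtype.val (Set.projIcc_of_mem zero_le_one (hz i))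
  have hmap : ∀ ρ : Measure (ι → ℝ), (∀ᵐ z ∂ρ, ∀ i, z i ∈ Set.Icc (0 : ℝ) 1) →
      (ρ.map c).map e = ρ := by
    intro ρ hρ
    rw [Measure.map_map hem hcm, Measure.map_congr (g := id), Measure.map_id]
    filter_upwards [hρ] with z hz using hce z hz
  rw [← hmap μ hμ, ← hmap ν hν]
  congr 1
  refine ext_of_integral_prod_pow_unitInterval fun p => ?_
  have hint : ∀ ρ : Measure (ι → ℝ), (∀ᵐ z ∂ρ, ∀ i, z i ∈ Set.Icc (0 : ℝ) 1) →
      ∫ z, ∏ i ∈ p.support, (z i : ℝ) ^ p i ∂(ρ.map c) = ∫ z, ∏ i ∈ p.support, z i ^ p i ∂ρ := by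
    intro ρ hρ
    rw [integral_map hcm.aemeasurable]
    · refine integral_congr_ae ?_
      filter_upwards [hρ] with z hz
      refine Finset.prod_congr rfl fun i _ => ?_
      rw [show ((c z i : unitInterval) : ℝ) = z i from congrFun (hce z hz) i]
    · refine Measurable.aestronglyMeasurable ?_
      exact Finset.measurable_prod _ fun i _ =>
        (measurable_subtype_coe.comp (measurable_pi_apply i)).pow_const _
  rw [hint μ hμ, hint ν hν, h p]

/-! ### Subtree sizes and the parameters of the GEM distributions -/

theorem card_filter_or_of_disjoint {x : Finset Node} {p q r : Node → Prop} [DecidablePred p]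
    [DecidablePred q] [DecidablePred r] (h : ∀ w, r w ↔ p w ∨ q w) (hd : ∀ w, p w → ¬ q w) :
    (x.filter r).card = (x.filter p).card + (x.filter q).card := by
  rw [← Finset.card_union_of_disjoint, ← Finset.filter_or]
  · exact congrArg _ (Finset.filter_congr fun w _ => h w)
  · exact Finset.disjoint_filter.2 fun w _ => hd w

theorem eq_of_child_prefix {u w : Node} {s t : ℕ} (hs : u ++ [s] <+: w) (ht : u ++ [t] <+: w) :
    s = t := by
  have h : u ++ [s] = u ++ [t] :=
    (List.prefix_of_prefix_length_le hs ht (by simp)).eq_of_length (by simp)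
  simpa using h

theorem youngerSize_eq_add (x : Finset Node) (u : Node) (i : ℕ) :
    youngerSize x u i = size x (u ++ [i + 1]) + youngerSize x u (i + 1) := by
  classical
  unfold youngerSize size
  refine card_filter_or_of_disjoint (fun w => ?_) ?_
  · constructor
    · rintro ⟨t, ht, h⟩
      rcases Nat.eq_or_lt_of_le ht with rfl | ht
      · exact Or.inl h
      · exact Or.inr ⟨t, ht, h⟩
    · rintro (h | ⟨t, ht, h⟩)
      · exact ⟨i + 1, Nat.lt_succ_self i, h⟩
      · exact ⟨t, by omega, h⟩
  · rintro w h ⟨t, ht, h'⟩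
    have := eq_of_child_prefix h h'
    omega

theorem size_eq_add {x : Finset Node} {u : Node} (hu : u ∈ x) :
    size x u = size x (u ++ [0]) + youngerSize x u 0 + 1 := by
  classical
  have h1 : size x u = (x.filter fun w => ∃ t, u ++ [t] <+: w).card + 1 := by
    rw [size, card_filter_or_of_disjoint (p := fun w => ∃ t, u ++ [t] <+: w) (q := fun w => w = u)]
    · rw [Finset.filter_eq' x u, if_pos hu, Finset.card_singleton]
    · intro w
      constructor
      · rintro ⟨z, rfl⟩
        cases z with
        | nil => simp
        | cons t z => exact Or.inl ⟨t, z, by simp⟩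
      · rintro (⟨t, h⟩ | rfl)
        · exact (List.prefix_append _ _).trans h
        · exact List.prefix_refl _
    · rintro w ⟨t, h⟩ rfl
      simpa using h.length_le
  rw [h1]
  congr 1
  unfold youngerSize size
  refine card_filter_or_of_disjoint (fun w => ?_) ?_
  · constructor
    · rintro ⟨t, h⟩
      rcases Nat.eq_zero_or_pos t with rfl | ht
      · exact Or.inl h
      · exact Or.inr ⟨t, ht, h⟩
    · rintro (h | ⟨t, ht, h⟩)
      · exact ⟨0, h⟩
      · exact ⟨t, h⟩
  · rintro w h ⟨t, ht, h'⟩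
    have := eq_of_child_prefix h h'
    omega

theorem size_eq_sum_add {x : Finset Node} {u : Node} (hu : u ∈ x) (i : ℕ) :
    size x u = ∑ t ∈ Finset.range (i + 1), size x (u ++ [t]) + (youngerSize x u i + 1) := by
  induction i with
  | zero => rw [size_eq_add hu]; simp; ring
  | succ i ih => rw [ih, youngerSize_eq_add x u i, Finset.sum_range_succ _ (i + 1)]; ring

/-- Children occupy an initial segment of the letters, so the last child counted from one is the
first free letter counted from zero. -/
theorem IsHarris.numChildren_eq {x : Finset Node} (hx : IsHarris x) (u : Node) :
    numChildren x u = nextChild x u := by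
  have h : (fun i => i + 1) '' {i : ℕ | 0 < size x (u ++ [i])} = Set.Icc 1 (nextChild x u) := by
    ext k
    simp only [hx.size_pos_iff, child_mem_iff hx, Set.mem_image, Set.mem_ofPred_eq, Set.mem_Icc]
    constructor
    · rintro ⟨i, hi, rfl⟩
      omega
    · rintro ⟨h1, h2⟩
      exact ⟨k - 1, by omega, by omega⟩
  rw [numChildren, h]
  rcases Nat.eq_zero_or_pos (nextChild x u) with h0 | h0
  · simp [h0]
  · exact csSup_Icc h0

theorem IsHarris.lt_length_childSizes_iff {x : Finset Node} (hx : IsHarris x) (u : Node) (i : ℕ) :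
    i < (childSizes x u).length ↔ u ++ [i] ∈ x := by
  rw [childSizes, List.length_map, List.length_range, hx.numChildren_eq, child_mem_iff hx]

theorem getElem_childSizes {x : Finset Node} {u : Node} {i : ℕ}
    (h : i < (childSizes x u).length) : (childSizes x u)[i] = size x (u ++ [i]) := by
  simp [childSizes]

theorem IsHarris.sum_drop_childSizes {x : Finset Node} (hx : IsHarris x) (u : Node) (i : ℕ) :
    ((childSizes x u).drop (i + 1)).sum = youngerSize x u i := by
  -- Downward induction on `i`, with `d` bounding the number of entries left in the list.
  obtain ⟨d, hd⟩ : ∃ d, (childSizes x u).length ≤ i + 1 + d := ⟨(childSizes x u).length, by omega⟩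
  induction d generalizing i with
  | zero =>
    rw [List.drop_eq_nil_of_le hd, hx.youngerSize_eq_zero, List.sum_nil]
    rw [← hx.lt_length_childSizes_iff]
    omega
  | succ d ih =>
    by_cases h : i + 1 < (childSizes x u).length
    · rw [List.drop_eq_getElem_cons h, List.sum_cons, ih (i + 1) (by omega), getElem_childSizes,
        youngerSize_eq_add x u i]
    · rw [List.drop_eq_nil_of_le (by omega), hx.youngerSize_eq_zero, List.sum_nil]
      rwa [← hx.lt_length_childSizes_iff]

/-- The link between urns and GEM parameters: the content of the urn is the parameter pair of the
factor. For an absent child, the factor Beta `(1, 1)` corresponds to the default content `(1, 1)`.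
-/
theorem IsHarris.gemFactor_childSizes {x : Finset Node} (hx : IsHarris x) (u : Node) (i : ℕ) :
    ∃ l r : ℕ, 1 ≤ l ∧ 1 ≤ r ∧ gemFactor (childSizes x u) i = betaMeasure (l : ℝ) (r : ℝ) ∧
      ∀ f, urnWeight f x (u, i) = f l r := by
  by_cases h : u ++ [i] ∈ x
  · have hpos := (hx.size_pos_iff _).2 h
    refine ⟨size x (u ++ [i]), youngerSize x u i + 1, hpos, by omega, ?_, ?_⟩
    · rw [gemFactor, dif_pos ((hx.lt_length_childSizes_iff u i).2 h), getElem_childSizes,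
        hx.sum_drop_childSizes]
      push_cast
      rw [add_comm]
    · intro f
      rw [urnWeight, if_neg hpos.ne']
  · refine ⟨1, 1, le_rfl, le_rfl, ?_, ?_⟩
    · rw [gemFactor, dif_neg fun h' => h ((hx.lt_length_childSizes_iff u i).1 h')]
      simp
    · intro f
      rw [urnWeight, if_pos]
      exact Nat.eq_zero_of_not_pos fun h' => h ((hx.size_pos_iff _).1 h')

theorem IsHarris.isProbabilityMeasure_gemFactor {x : Finset Node} (hx : IsHarris x) (u : Node)
    (i : ℕ) : IsProbabilityMeasure (gemFactor (childSizes x u) i) := by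
  obtain ⟨l, r, hl, hr, h, -⟩ := hx.gemFactor_childSizes u i
  rw [h]
  exact isProbabilityMeasureBeta (by exact_mod_cast hl) (by exact_mod_cast hr)

theorem IsHarris.integral_pow_gemFactor {x : Finset Node} (hx : IsHarris x) (u : Node)
    (i p : ℕ) :
    ∫ z, z ^ p ∂gemFactor (childSizes x u) i = urnWeight (urnMoment p 0) x (u, i) := by
  obtain ⟨l, r, hl, hr, h, hf⟩ := hx.gemFactor_childSizes u i
  rw [h, hf, integral_pow_betaMeasure_eq_urnMoment p hl hr]

theorem IsHarris.ae_mem_Icc_gemFactor {x : Finset Node} (hx : IsHarris x) (u : Node) (i : ℕ) :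
    ∀ᵐ z ∂gemFactor (childSizes x u) i, z ∈ Set.Icc (0 : ℝ) 1 := by
  obtain ⟨l, r, -, -, h, -⟩ := hx.gemFactor_childSizes u i
  rw [h]
  exact ae_mem_Icc_betaMeasure _ _

theorem urnWeight_singleton_nil (f : ℕ → ℕ → ℝ) (v : Node × ℕ) : urnWeight f {[]} v = f 1 1 := by
  rw [urnWeight, if_pos]
  rw [size, Finset.card_eq_zero, Finset.filter_singleton, if_neg]
  simp

/-! ### Splitting fractions of the limit -/

/-- The mass of the subtree of `u`. -/
noncomputable def mass (μ : ProbabilityMeasure NodeBar) (u : Node) : ℝ :=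
  (μ : Measure NodeBar).real (cyl u)

/-- The mass of the subtree of `u` without the subtrees of the children of `u` before `i`. -/
noncomputable def restMass (μ : ProbabilityMeasure NodeBar) (v : Node × ℕ) : ℝ :=
  mass μ v.1 - ∑ t ∈ Finset.range v.2, mass μ (v.1 ++ [t])

/-- The fraction of the mass at `v = (u, i)` that belongs to the child `i` of `u`. -/
noncomputable def fraction (μ : ProbabilityMeasure NodeBar) (v : Node × ℕ) : ℝ :=
  mass μ (v.1 ++ [v.2]) / restMass μ v

theorem restMass_succ (μ : ProbabilityMeasure NodeBar) (u : Node) (i : ℕ) :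
    restMass μ (u, i + 1) = restMass μ (u, i) - mass μ (u ++ [i]) := by
  simp only [restMass, Finset.sum_range_succ]
  ring

theorem restMass_zero (μ : ProbabilityMeasure NodeBar) (u : Node) :
    restMass μ (u, 0) = mass μ u := by
  simp [restMass]

theorem one_sub_fraction {μ : ProbabilityMeasure NodeBar} {u : Node} {i : ℕ}
    (h : restMass μ (u, i) ≠ 0) :
    1 - fraction μ (u, i) = restMass μ (u, i + 1) / restMass μ (u, i) := by
  rw [restMass_succ, fraction, sub_div, div_self h]

theorem mul_prod_one_sub_fraction {μ : ProbabilityMeasure NodeBar} {u : Node}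
    (h : ∀ i, restMass μ (u, i) ≠ 0) (i : ℕ) :
    mass μ u * ∏ t ∈ Finset.range i, (1 - fraction μ (u, t)) = restMass μ (u, i) := by
  induction i with
  | zero => simp [restMass_zero]
  | succ i ih =>
    rw [Finset.prod_range_succ, ← mul_assoc, ih, one_sub_fraction (h i), mul_div_cancel₀ _ (h i)]

theorem rho_eq_stickBreaking {μ : ProbabilityMeasure NodeBar} {u : Node}
    (h : ∀ i, restMass μ (u, i) ≠ 0) : rho μ u = stickBreaking fun i => fraction μ (u, i) := by
  funext i
  have h0 : mass μ u ≠ 0 := by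
    rw [← restMass_zero]
    exact h 0
  have h1 := mul_prod_one_sub_fraction h i
  have h2 : ∏ t ∈ Finset.range i, (1 - fraction μ (u, t)) = restMass μ (u, i) / mass μ u := by
    rw [← h1, mul_div_cancel_left₀ _ h0]
  rw [stickBreaking, h2, fraction, div_mul_div_cancel₀ (h i)]
  rfl

/-- The trajectories of the Harris chain, up to null sets. -/
structure IsTrajectory (x : ℕ → Finset Node) : Prop where
  isHarris : ∀ k, IsHarris (x (k + 1))
  card_eq : ∀ k, (x (k + 1)).card = k + 1

section Limit

variable {x : ℕ → Finset Node} {μ : ProbabilityMeasure NodeBar}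

theorem IsTrajectory.tendsto_size (hx : IsTrajectory x) (hμ : TendstoDM x μ) (u : Node) :
    Tendsto (fun m : ℕ => (size (x m) u : ℝ) / m) atTop (𝓝 (mass μ u)) := by
  refine (hμ u).congr' ?_
  filter_upwards [eventually_ge_atTop 1] with m hm
  obtain ⟨k, rfl⟩ : ∃ k, m = k + 1 := ⟨m - 1, by omega⟩
  rw [hx.card_eq]

theorem IsTrajectory.mass_nil (hx : IsTrajectory x) (hμ : TendstoDM x μ) : mass μ [] = 1 := by
  refine tendsto_nhds_unique (hx.tendsto_size hμ []) (tendsto_const_nhds.congr' ?_)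
  filter_upwards [eventually_ge_atTop 1] with m hm
  obtain ⟨k, rfl⟩ : ∃ k, m = k + 1 := ⟨m - 1, by omega⟩
  have : size (x (k + 1)) [] = k + 1 := by
    rw [size, Finset.filter_true_of_mem (by simp), hx.card_eq]
  rw [this, div_self (by positivity)]

theorem IsTrajectory.eventually_mem (hx : IsTrajectory x) (hμ : TendstoDM x μ) {u : Node}
    (hu : 0 < mass μ u) : ∀ᶠ m in atTop, IsHarris (x m) ∧ u ∈ x m := by
  filter_upwards [eventually_ge_atTop 1, (hx.tendsto_size hμ u).eventually (lt_mem_nhds hu)]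
    with m hm hpos
  obtain ⟨k, rfl⟩ : ∃ k, m = k + 1 := ⟨m - 1, by omega⟩
  refine ⟨hx.isHarris k, ((hx.isHarris k).size_pos_iff u).1 (Nat.pos_of_ne_zero fun h => ?_)⟩
  simp [h] at hpos

theorem IsTrajectory.tendsto_youngerSize (hx : IsTrajectory x) (hμ : TendstoDM x μ) {u : Node}
    (hu : 0 < mass μ u) (i : ℕ) :
    Tendsto (fun m : ℕ => ((youngerSize (x m) u i + 1 : ℕ) : ℝ) / m) atTop
      (𝓝 (restMass μ (u, i + 1))) := by
  have h := (hx.tendsto_size hμ u).sub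
    (tendsto_finsetSum (Finset.range (i + 1)) fun t _ => hx.tendsto_size hμ (u ++ [t]))
  refine h.congr' ?_
  filter_upwards [hx.eventually_mem hμ hu] with m hm
  rw [size_eq_sum_add hm.2 i, ← Finset.sum_div, ← sub_div]
  push_cast
  ring

theorem mass_nonneg (μ : ProbabilityMeasure NodeBar) (u : Node) : 0 ≤ mass μ u := measureReal_nonneg

theorem IsTrajectory.restMass_succ_nonneg (hx : IsTrajectory x) (hμ : TendstoDM x μ) {u : Node}
    (hu : 0 < mass μ u) (i : ℕ) : 0 ≤ restMass μ (u, i + 1) :=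
  ge_of_tendsto' (hx.tendsto_youngerSize hμ hu i) fun _ => by positivity

theorem IsTrajectory.fraction_mem_Icc (hx : IsTrajectory x) (hμ : TendstoDM x μ) {v : Node × ℕ}
    (hu : 0 < mass μ v.1) (hv : 0 < restMass μ v) : fraction μ v ∈ Set.Icc (0 : ℝ) 1 := by
  refine ⟨div_nonneg (mass_nonneg _ _) hv.le, (div_le_one hv).2 ?_⟩
  have := hx.restMass_succ_nonneg hμ hu v.2
  rw [restMass_succ] at this
  linarith

/-- Positive mass at the split forces its child to appear eventually, so that the default value of
`urnWeight` plays no role in the limit. -/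
theorem IsTrajectory.tendsto_urnWeight (hx : IsTrajectory x) (hμ : TendstoDM x μ) {v : Node × ℕ}
    (hu : 0 < mass μ v.1) (hv : 0 < restMass μ v) (p q : ℕ) :
    Tendsto (fun m => urnWeight (urnMoment p q) (x m) v) atTop
      (𝓝 (fraction μ v ^ p * (1 - fraction μ v) ^ q)) := by
  obtain ⟨u, i⟩ := v
  have hL := hx.tendsto_size hμ (u ++ [i])
  have hR := hx.tendsto_youngerSize hμ hu i
  have hadd : mass μ (u ++ [i]) + restMass μ (u, i + 1) = restMass μ (u, i) := by
    rw [restMass_succ]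
    ring
  have h := tendsto_urnMoment (by rw [hadd]; exact hv.ne') hL hR p q
  rw [hadd, ← one_sub_fraction hv.ne'] at h
  refine h.congr' ?_
  have hLR := hL.add hR
  rw [hadd] at hLR
  -- Without the child `i` the split contains the node `u` only, a proportion `1 / m` that is too
  -- small for large `m`.
  have h1 : ∀ᶠ m : ℕ in atTop, (1 : ℝ) / m < restMass μ (u, i) / 2 :=
    (tendsto_const_div_atTop_nhds_zero_nat 1).eventually (gt_mem_nhds (half_pos hv))
  filter_upwards [hx.eventually_mem hμ hu, h1, hLR.eventually (lt_mem_nhds (half_lt_self hv))]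
    with m hm hm1 hm2
  rw [urnWeight, if_neg]
  intro h0
  have hy : youngerSize (x m) u i = 0 := by
    refine hm.1.youngerSize_eq_zero fun h' => ?_
    exact ((hm.1.size_pos_iff _).2 (hm.1.sibling_mem _ _ h')).ne' h0
  simp only at h0
  rw [h0, hy] at hm2
  simp only [Nat.cast_zero, zero_div, zero_add, Nat.cast_one] at hm2
  linarith

end Limit

/-! ### Stick-breaking sequences with sum one -/

theorem sum_stickBreaking (ζ : ℕ → ℝ) (k : ℕ) :
    ∑ i ∈ Finset.range k, stickBreaking ζ i = 1 - ∏ i ∈ Finset.range k, (1 - ζ i) := by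
  induction k with
  | zero => simp
  | succ k ih =>
    rw [Finset.sum_range_succ, ih, Finset.prod_range_succ, stickBreaking]
    ring

/-- The partial sums are one minus the length of the remaining stick. That length is nonincreasing,
so it tends to `0` as soon as it takes arbitrarily small values. -/
theorem stickBreaking_mem_simplex {ζ : ℕ → ℝ} (hζ : ∀ i, ζ i ∈ Set.Icc (0 : ℝ) 1)
    (h : ∀ ε > 0, ∃ k, ∏ i ∈ Finset.range k, (1 - ζ i) < ε) : stickBreaking ζ ∈ simplex := by
  have hprod : ∀ k, 0 ≤ ∏ i ∈ Finset.range k, (1 - ζ i) := fun k =>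
    Finset.prod_nonneg fun i _ => sub_nonneg.2 (hζ i).2
  have hnonneg : ∀ i, 0 ≤ stickBreaking ζ i := fun i => mul_nonneg (hζ i).1 (hprod i)
  refine ⟨hnonneg, (hasSum_iff_tendsto_nat_of_nonneg hnonneg 1).2 ?_⟩
  simp_rw [sum_stickBreaking]
  have hanti : Antitone fun k => ∏ i ∈ Finset.range k, (1 - ζ i) := by
    refine antitone_nat_of_succ_le fun k => ?_
    rw [Finset.prod_range_succ]
    exact mul_le_of_le_one_right (hprod k) (by linarith [(hζ k).1])
  have hlim : Tendsto (fun k => ∏ i ∈ Finset.range k, (1 - ζ i)) atTop (𝓝 0) := by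
    refine tendsto_order.2 ⟨fun a ha => Eventually.of_forall fun k => ha.trans_le (hprod k),
      fun a ha => ?_⟩
    obtain ⟨k, hk⟩ := h a ha
    filter_upwards [eventually_ge_atTop k] with m hm
    exact (hanti hm).trans_lt hk
  simpa using tendsto_const_nhds.sub hlim

/-! ### The conditional law of the splitting fractions -/

theorem measurable_mass (u : Node) : Measurable fun μ : ProbabilityMeasure NodeBar => mass μ u := by
  have h : MeasurableSet (cyl u) := MeasurableSpace.measurableSet_generateFrom ⟨u, rfl⟩
  exact ((Measure.measurable_coe h).comp measurable_subtype_coe).ennreal_toReal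

theorem measurable_restMass (v : Node × ℕ) :
    Measurable fun μ : ProbabilityMeasure NodeBar => restMass μ v :=
  (measurable_mass _).sub (Finset.measurable_sum _ fun _ _ => measurable_mass _)

theorem measurable_fraction (v : Node × ℕ) :
    Measurable fun μ : ProbabilityMeasure NodeBar => fraction μ v :=
  (measurable_mass _).div (measurable_restMass v)

theorem measurable_stickBreaking : Measurable stickBreaking := by
  refine measurable_pi_lambda _ fun i => (measurable_pi_apply i).mul ?_
  exact Finset.measurable_prod _ fun j _ => measurable_const.sub (measurable_pi_apply j)

/-- Markov's inequality, for the levels `1 / (N + 1)`. -/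
theorem ae_exists_lt_of_tendsto_integral {Ω : Type*} [MeasurableSpace Ω] {P : Measure Ω}
    [IsFiniteMeasure P] {D : ℕ → Ω → ℝ} (hD : ∀ k, 0 ≤ᵐ[P] D k) (hint : ∀ k, Integrable (D k) P)
    (hlim : Tendsto (fun k => ∫ ω, D k ω ∂P) atTop (𝓝 0)) :
    ∀ᵐ ω ∂P, ∀ ε > 0, ∃ k, D k ω < ε := by
  have key : ∀ N : ℕ, ∀ᵐ ω ∂P, ∃ k, D k ω < 1 / ((N : ℝ) + 1) := by
    intro N
    set ε : ℝ := 1 / ((N : ℝ) + 1) with hε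
    have hε0 : 0 < ε := by positivity
    have hle : ∀ k, P.real {ω | ¬ ∃ k, D k ω < ε} ≤ (∫ ω, D k ω ∂P) / ε := by
      intro k
      rw [le_div_iff₀' hε0]
      refine le_trans ?_ (mul_meas_ge_le_integral_of_nonneg (hD k) (hint k) ε)
      refine mul_le_mul_of_nonneg_left (measureReal_mono fun ω hω => ?_) hε0.le
      exact not_lt.1 fun h => hω ⟨k, h⟩
    have h0 : P.real {ω | ¬ ∃ k, D k ω < ε} ≤ 0 := by
      have := hlim.div_const ε
      rw [zero_div] at this
      exact ge_of_tendsto' this hle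
    rw [ae_iff]
    exact (measureReal_eq_zero_iff).1 (le_antisymm h0 measureReal_nonneg)
  filter_upwards [ae_all_iff.2 key] with ω hω ε hε
  obtain ⟨N, hN⟩ := exists_nat_one_div_lt hε
  obtain ⟨k, hk⟩ := hω N
  exact ⟨k, hk.trans hN⟩

theorem ae_isTrajectory {Ω : Type*} [MeasurableSpace Ω] {P : Measure Ω} {X : ℕ → Ω → Finset Node}
    (hX : HasLaw (fun ω n => X n ω) harrisLaw P) : ∀ᵐ ω ∂P, IsTrajectory fun n => X n ω := by
  filter_upwards [ae_isHarris hX] with ω hω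
  exact ⟨fun k => (hω k).2.1, fun k => (hω k).2.2⟩

theorem isHarris_of_measure_ne_zero {Ω : Type*} [MeasurableSpace Ω] {P : Measure Ω}
    {X : ℕ → Ω → Finset Node} (hX : HasLaw (fun ω n => X n ω) harrisLaw P) {n : ℕ}
    (hn : 1 ≤ n) {x : Finset Node} (hP : P (X n ⁻¹' {x}) ≠ 0) : IsHarris x := by
  by_contra hx
  refine hP (measure_mono_null ?_ (ae_iff.1 (ae_isTrajectory hX)))
  rintro ω (rfl : X n ω = x) h
  obtain ⟨k, rfl⟩ : ∃ k, n = k + 1 := ⟨n - 1, by omega⟩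
  exact hx (h.isHarris k)

section Chain

variable {Ω : Type*} [MeasurableSpace Ω] {P : Measure Ω} [IsProbabilityMeasure P]
  {X : ℕ → Ω → Finset Node} {Xinf : Ω → ProbabilityMeasure NodeBar}

theorem integrable_of_mem_Icc {Y : Ω → ℝ} {Q : Measure Ω} [IsFiniteMeasure Q] (hY : Measurable Y)
    (h : ∀ᵐ ω ∂Q, Y ω ∈ Set.Icc (0 : ℝ) 1) : Integrable Y Q := by
  refine Integrable.of_bound (C := 1) hY.aestronglyMeasurable ?_
  filter_upwards [h] with ω hω
  rw [Real.norm_of_nonneg hω.1]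
  exact hω.2

/-- The conditional joint moments of the splitting fractions. -/
theorem setIntegral_prod_fraction (hX : HasLaw (fun ω n => X n ω) harrisLaw P)
    (hlim : ∀ᵐ ω ∂P, TendstoDM (fun n => X n ω) (Xinf ω)) (F : Finset (Node × ℕ))
    (hF : ∀ v ∈ F, ∀ᵐ ω ∂P, 0 < mass (Xinf ω) v.1 ∧ 0 < restMass (Xinf ω) v)
    (p q : Node × ℕ → ℕ) {n : ℕ} (hn : 1 ≤ n) (x : Finset Node) :
    ∫ ω in X n ⁻¹' {x}, ∏ v ∈ F, (fraction (Xinf ω) v ^ p v * (1 - fraction (Xinf ω) v) ^ q v) ∂P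
      = P.real (X n ⁻¹' {x}) * ∏ v ∈ F, urnWeight (urnMoment (p v) (q v)) x v := by
  have hF' : ∀ᵐ ω ∂P, ∀ v ∈ F, 0 < mass (Xinf ω) v.1 ∧ 0 < restMass (Xinf ω) v :=
    (ae_ball_iff F.countable_toSet).2 hF
  have hXm : ∀ m, AEMeasurable (X m) P := fun m =>
    (measurable_pi_apply m).comp_aemeasurable hX.aemeasurable
  have hbound : ∀ (y : Finset Node), ∏ v ∈ F, urnWeight (urnMoment (p v) (q v)) y v
      ∈ Set.Icc (0 : ℝ) 1 := by
    intro y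
    have h : ∀ v ∈ F, urnWeight (urnMoment (p v) (q v)) y v ∈ Set.Icc (0 : ℝ) 1 := by
      intro v _
      unfold urnWeight
      split_ifs <;> exact ⟨urnMoment_nonneg _ _ _ _, urnMoment_le_one _ _ _ _⟩
    exact ⟨Finset.prod_nonneg fun v hv => (h v hv).1,
      Finset.prod_le_one (fun v hv => (h v hv).1) fun v hv => (h v hv).2⟩
  have h1 := tendsto_integral_of_dominated_convergence (μ := P.restrict (X n ⁻¹' {x}))
    (F := fun m ω => ∏ v ∈ F, urnWeight (urnMoment (p v) (q v)) (X m ω) v)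
    (f := fun ω => ∏ v ∈ F, (fraction (Xinf ω) v ^ p v * (1 - fraction (Xinf ω) v) ^ q v))
    (fun _ => 1) ?_ (integrable_const 1) ?_ ?_
  -- By harmonicity the integrals do not depend on `m ≥ n`, so their limit is the value at time `n`.
  · refine tendsto_nhds_unique h1 (tendsto_const_nhds.congr' ?_)
    filter_upwards [eventually_ge_atTop n] with m hm
    exact ((treeHarmonic_prod_urnWeight F _ fun v _ =>
      urnHarmonic_urnMoment (p v) (q v)).setIntegral_eq hX hn hm x).symm
  · intro m
    exact ((measurable_of_countable fun y : Finset Node =>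
      ∏ v ∈ F, urnWeight (urnMoment (p v) (q v)) y v).comp_aemeasurable
        (hXm m)).aestronglyMeasurable.restrict
  · refine fun m => ae_of_all _ fun ω => ?_
    rw [Real.norm_of_nonneg (hbound _).1]
    exact (hbound _).2
  · refine ae_restrict_of_ae ?_
    filter_upwards [hF', hlim, ae_isTrajectory hX] with ω h2 h3 h4
    exact tendsto_finsetProd _ fun v hv =>
      h4.tendsto_urnWeight h3 (h2 v hv).1 (h2 v hv).2 _ _

theorem integral_prod_fraction (hX : HasLaw (fun ω n => X n ω) harrisLaw P)
    (hlim : ∀ᵐ ω ∂P, TendstoDM (fun n => X n ω) (Xinf ω)) (F : Finset (Node × ℕ))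
    (hF : ∀ v ∈ F, ∀ᵐ ω ∂P, 0 < mass (Xinf ω) v.1 ∧ 0 < restMass (Xinf ω) v)
    (p q : Node × ℕ → ℕ) :
    ∫ ω, ∏ v ∈ F, (fraction (Xinf ω) v ^ p v * (1 - fraction (Xinf ω) v) ^ q v) ∂P
      = ∏ v ∈ F, urnMoment (p v) (q v) 1 1 := by
  have h1 : ∀ᵐ ω ∂P, ω ∈ X 1 ⁻¹' {{[]}} := by
    filter_upwards [ae_isHarris hX] with ω hω using (hω 0).1
  have h2 : P.restrict (X 1 ⁻¹' {{[]}}) = P := Measure.restrict_eq_self_of_ae_mem h1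
  have h3 : P.real (X 1 ⁻¹' {{[]}}) = 1 := by
    rw [measureReal_def, ← Measure.restrict_apply_univ, h2, measure_univ, ENNReal.toReal_one]
  have h := setIntegral_prod_fraction hX hlim F hF p q le_rfl {[]}
  rw [h2, h3, one_mul] at h
  rw [h]
  exact Finset.prod_congr rfl fun v _ => urnWeight_singleton_nil _ v

/-- Unconditionally the fraction has the moments of a uniform variable: its powers and those of its
complement have means `1 / (p + 1)`, tending to `0`, which excludes the values `1` and `0`.
Positivity is assumed at `v` only, so that the result can drive the induction for
`ae_mass_pos_restMass_pos`. -/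
theorem ae_fraction_mem_Ioo (hX : HasLaw (fun ω n => X n ω) harrisLaw P)
    (hXinf : Measurable Xinf)
    (hlim : ∀ᵐ ω ∂P, TendstoDM (fun n => X n ω) (Xinf ω)) (v : Node × ℕ)
    (hv : ∀ᵐ ω ∂P, 0 < mass (Xinf ω) v.1 ∧ 0 < restMass (Xinf ω) v) :
    ∀ᵐ ω ∂P, fraction (Xinf ω) v ∈ Set.Ioo (0 : ℝ) 1 := by
  have hmeas : Measurable fun ω => fraction (Xinf ω) v := (measurable_fraction v).comp hXinf
  have hIcc : ∀ᵐ ω ∂P, fraction (Xinf ω) v ∈ Set.Icc (0 : ℝ) 1 := by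
    filter_upwards [hv, hlim, ae_isTrajectory hX] with ω h2 h3 h4
    exact h4.fraction_mem_Icc h3 h2.1 h2.2
  have hmom : ∀ p q, ∫ ω, fraction (Xinf ω) v ^ p * (1 - fraction (Xinf ω) v) ^ q ∂P
      = urnMoment p q 1 1 := by
    intro p q
    simpa using integral_prod_fraction hX hlim {v} (by simpa using hv) (fun _ => p) (fun _ => q)
  have hone : Tendsto (fun p : ℕ => ((p : ℝ) + 1)⁻¹) atTop (𝓝 0) := by
    simpa using tendsto_one_div_add_atTop_nhds_zero_nat (𝕜 := ℝ)
  have hl := ae_exists_lt_of_tendsto_integral (P := P) (D := fun p ω => fraction (Xinf ω) v ^ p)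
    (fun p => by filter_upwards [hIcc] with ω hω using pow_nonneg hω.1 p)
    (fun p => integrable_of_mem_Icc (hmeas.pow_const p) (by
      filter_upwards [hIcc] with ω hω using ⟨pow_nonneg hω.1 p, pow_le_one₀ hω.1 hω.2⟩))
    (by
      refine hone.congr fun p => ?_
      simpa [urnMoment_one_one_left] using (hmom p 0).symm)
  have hr := ae_exists_lt_of_tendsto_integral (P := P)
    (D := fun p ω => (1 - fraction (Xinf ω) v) ^ p)
    (fun p => by filter_upwards [hIcc] with ω hω using pow_nonneg (sub_nonneg.2 hω.2) p)
    (fun p => integrable_of_mem_Icc ((measurable_const.sub hmeas).pow_const p) (by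
      filter_upwards [hIcc] with ω hω
      exact ⟨pow_nonneg (sub_nonneg.2 hω.2) p,
        pow_le_one₀ (sub_nonneg.2 hω.2) (by linarith [hω.1])⟩))
    (by
      refine hone.congr fun p => ?_
      simpa [urnMoment_one_one_right] using (hmom 0 p).symm)
  filter_upwards [hIcc, hl, hr] with ω h0 h1 h2
  refine ⟨lt_of_le_of_ne h0.1 fun h => ?_, lt_of_le_of_ne h0.2 fun h => ?_⟩
  · obtain ⟨k, hk⟩ := h2 1 one_pos
    simp [← h] at hk
  · obtain ⟨k, hk⟩ := h1 1 one_pos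
    simp [h] at hk

/-- A fraction strictly between `0` and `1` passes positive mass to both sides of a split: to the
child, and to the rest. The induction runs over the words and, for each word, over its children. -/
theorem ae_mass_pos_restMass_pos (hX : HasLaw (fun ω n => X n ω) harrisLaw P)
    (hXinf : Measurable Xinf)
    (hlim : ∀ᵐ ω ∂P, TendstoDM (fun n => X n ω) (Xinf ω)) (v : Node × ℕ) :
    ∀ᵐ ω ∂P, 0 < mass (Xinf ω) v.1 ∧ 0 < restMass (Xinf ω) v := by
  obtain ⟨u, i⟩ := v
  have hstep : ∀ u, (∀ᵐ ω ∂P, 0 < mass (Xinf ω) u) → ∀ i,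
      ∀ᵐ ω ∂P, 0 < mass (Xinf ω) u ∧ 0 < restMass (Xinf ω) (u, i) := by
    intro u hu i
    induction i with
    | zero =>
      filter_upwards [hu] with ω hω
      exact ⟨hω, by rwa [restMass_zero]⟩
    | succ i ih =>
      filter_upwards [ih, ae_fraction_mem_Ioo hX hXinf hlim (u, i) ih] with ω h1 h2
      refine ⟨h1.1, ?_⟩
      have h3 := one_sub_fraction h1.2.ne'
      have h4 : 0 < 1 - fraction (Xinf ω) (u, i) := sub_pos.2 h2.2
      rw [h3] at h4
      exact (div_pos_iff_of_pos_right h1.2).1 h4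
  have hmass : ∀ᵐ ω ∂P, 0 < mass (Xinf ω) u := by
    induction u using List.reverseRecOn with
    | nil =>
      filter_upwards [hlim, ae_isTrajectory hX] with ω h1 h2
      rw [h2.mass_nil h1]
      exact one_pos
    | append_singleton u t ih =>
      have h := hstep u ih t
      filter_upwards [h, ae_fraction_mem_Ioo hX hXinf hlim (u, t) h] with ω h1 h2
      exact (div_pos_iff_of_pos_right h1.2).1 h2.1
  exact hstep u hmass i

theorem ae_fraction_mem_Icc (hX : HasLaw (fun ω n => X n ω) harrisLaw P)
    (hXinf : Measurable Xinf)
    (hlim : ∀ᵐ ω ∂P, TendstoDM (fun n => X n ω) (Xinf ω)) :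
    ∀ᵐ ω ∂P, ∀ v, fraction (Xinf ω) v ∈ Set.Icc (0 : ℝ) 1 :=
  ae_all_iff.2 fun v => (ae_fraction_mem_Ioo hX hXinf hlim v
    (ae_mass_pos_restMass_pos hX hXinf hlim v)).mono fun _ h => Set.Ioo_subset_Icc_self h

theorem ae_rho_eq_stickBreaking (hX : HasLaw (fun ω n => X n ω) harrisLaw P)
    (hXinf : Measurable Xinf)
    (hlim : ∀ᵐ ω ∂P, TendstoDM (fun n => X n ω) (Xinf ω)) :
    ∀ᵐ ω ∂P, ∀ u, rho (Xinf ω) u = stickBreaking fun i => fraction (Xinf ω) (u, i) := by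
  filter_upwards [ae_all_iff.2 fun v => ae_mass_pos_restMass_pos hX hXinf hlim v] with ω h u
  exact rho_eq_stickBreaking fun i => (h (u, i)).2.ne'

theorem ae_rho_mem_simplex (hX : HasLaw (fun ω n => X n ω) harrisLaw P)
    (hXinf : Measurable Xinf)
    (hlim : ∀ᵐ ω ∂P, TendstoDM (fun n => X n ω) (Xinf ω)) :
    ∀ᵐ ω ∂P, ∀ u, rho (Xinf ω) u ∈ simplex := by
  have hIcc := ae_fraction_mem_Icc hX hXinf hlim
  have key : ∀ u : Node, ∀ᵐ ω ∂P, ∀ ε > 0,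
      ∃ k, ∏ i ∈ Finset.range k, (1 - fraction (Xinf ω) (u, i)) < ε := by
    intro u
    have hprod : ∀ k, ∀ᵐ ω ∂P, ∏ i ∈ Finset.range k, (1 - fraction (Xinf ω) (u, i))
        ∈ Set.Icc (0 : ℝ) 1 := by
      intro k
      filter_upwards [hIcc] with ω hω
      exact ⟨Finset.prod_nonneg fun i _ => sub_nonneg.2 (hω _).2,
        Finset.prod_le_one (fun i _ => sub_nonneg.2 (hω _).2)
          fun i _ => by linarith [(hω (u, i)).1]⟩
    refine ae_exists_lt_of_tendsto_integral (fun k => ?_) (fun k => ?_) ?_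
    · filter_upwards [hprod k] with ω hω using hω.1
    · exact integrable_of_mem_Icc (Finset.measurable_prod _ fun i _ =>
        measurable_const.sub ((measurable_fraction _).comp hXinf)) (hprod k)
    -- The mean length of the stick after `k` breaks is `2⁻¹ ^ k`, by the unconditional joint
    -- moments with `p = 0` and `q = 1`.
    · have hpow : Tendsto (fun k : ℕ => (2⁻¹ : ℝ) ^ k) atTop (𝓝 0) :=
        tendsto_pow_atTop_nhds_zero_of_lt_one (by norm_num) (by norm_num)
      refine hpow.congr fun k => ?_
      have h := integral_prod_fraction hX hlim
        ((Finset.range k).map ⟨fun i => (u, i), Prod.mk_right_injective u⟩)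
        (fun v _ => ae_mass_pos_restMass_pos hX hXinf hlim v) (fun _ => 0) (fun _ => 1)
      simp only [Finset.prod_map, Function.Embedding.coeFn_mk, pow_zero, pow_one, one_mul,
        Finset.prod_const, Finset.card_map, Finset.card_range, urnMoment_one_one_right] at h
      rw [h]
      norm_num
  filter_upwards [hIcc, ae_all_iff.2 key, ae_rho_eq_stickBreaking hX hXinf hlim] with ω h1 h2 h3 u
  rw [h3 u]
  exact stickBreaking_mem_simplex (fun i => h1 (u, i)) (h2 u)

theorem integral_prod_pow_infinitePi {ι : Type*} {μ : ι → Measure ℝ}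
    [∀ i, IsProbabilityMeasure (μ i)] (F : Finset ι) (p : ι → ℕ) :
    ∫ z, ∏ i ∈ F, z i ^ p i ∂Measure.infinitePi μ = ∏ i ∈ F, ∫ z, z ^ p i ∂μ i := by
  have h := integral_restrict_infinitePi (μ := μ) (s := F)
    (f := fun z : F → ℝ => ∏ i, z i ^ p i)
    (Finset.measurable_prod _ fun i _ =>
      (measurable_pi_apply i).pow_const _).aestronglyMeasurable
  rw [integral_fintype_prod_eq_prod (fun (i : F) (z : ℝ) => z ^ p i)] at h
  rw [← Finset.prod_coe_sort F, ← h]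
  refine integral_congr_ae (ae_of_all _ fun z => ?_)
  exact (Finset.prod_coe_sort F fun i => z i ^ p i).symm

/-- Given `X n = x`, the splitting fractions are independent and have the laws of the factors of
the GEM distributions. -/
theorem hasLaw_fraction (hX : HasLaw (fun ω n => X n ω) harrisLaw P) (hXinf : Measurable Xinf)
    (hlim : ∀ᵐ ω ∂P, TendstoDM (fun n => X n ω) (Xinf ω)) {n : ℕ} (hn : 1 ≤ n)
    {x : Finset Node} (hx : IsHarris x) (hP : P (X n ⁻¹' {x}) ≠ 0) :
    HasLaw (fun ω v => fraction (Xinf ω) v)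
      (Measure.infinitePi fun v : Node × ℕ => gemFactor (childSizes x v.1) v.2)
      (P[|X n ⁻¹' {x}]) := by
  have hprob : ∀ v : Node × ℕ, IsProbabilityMeasure (gemFactor (childSizes x v.1) v.2) :=
    fun v => hx.isProbabilityMeasure_gemFactor v.1 v.2
  have hcond : IsProbabilityMeasure (P[|X n ⁻¹' {x}]) := cond_isProbabilityMeasure hP
  have hac : P[|X n ⁻¹' {x}] ≪ P := cond_absolutelyContinuous
  have hmeas : Measurable fun ω v => fraction (Xinf ω) v :=
    measurable_pi_lambda _ fun v => (measurable_fraction v).comp hXinf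
  refine ⟨hmeas.aemeasurable, ?_⟩
  have := Measure.isProbabilityMeasure_map (μ := P[|X n ⁻¹' {x}]) hmeas.aemeasurable
  have hIcc : MeasurableSet {z : Node × ℕ → ℝ | ∀ v, z v ∈ Set.Icc (0 : ℝ) 1} := by
    rw [Set.ofPred_forall]
    exact MeasurableSet.iInter fun v => measurable_pi_apply v measurableSet_Icc
  refine ext_of_integral_prod_pow ?_ ?_ fun p => ?_
  · rw [ae_map_iff hmeas.aemeasurable hIcc]
    exact hac.ae_le (ae_fraction_mem_Icc hX hXinf hlim)
  · rw [ae_all_iff]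
    intro v
    have h := hx.ae_mem_Icc_gemFactor v.1 v.2
    rw [← Measure.infinitePi_map_eval (fun v : Node × ℕ => gemFactor (childSizes x v.1) v.2) v] at h
    exact ae_of_ae_map (measurable_pi_apply v).aemeasurable h
  · rw [integral_map hmeas.aemeasurable, integral_prod_pow_infinitePi, ProbabilityTheory.cond,
      integral_smul_measure]
    -- Monomials in the fractions determine the law, so the exponents of the complements are set to
    -- `0`.
    · have h := setIntegral_prod_fraction hX hlim p.support
        (fun v _ => ae_mass_pos_restMass_pos hX hXinf hlim v) p (fun _ => 0) hn x
      simp only [pow_zero, mul_one] at h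
      rw [h, measureReal_def, smul_eq_mul, ENNReal.toReal_inv, inv_mul_cancel_left₀]
      · exact Finset.prod_congr rfl fun v _ => (hx.integral_pow_gemFactor v.1 v.2 _).symm
      · exact (ENNReal.toReal_pos hP (measure_ne_top _ _)).ne'
    · exact (Finset.measurable_prod _ fun v _ =>
        (measurable_pi_apply v).pow_const _).aestronglyMeasurable

end Chain

end HarrisChain

/-! ### From splitting fractions to relative weights -/

open HarrisChain in
theorem theorem4 {Ω : Type*} [MeasurableSpace Ω] (P : Measure Ω) [IsProbabilityMeasure P]
    (X : ℕ → Ω → Finset Node) (hX : HasLaw (fun ω n => X n ω) harrisLaw P)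
    (Xinf : Ω → ProbabilityMeasure NodeBar) (hXinf_meas : Measurable Xinf)
    (hXinf : ∀ᵐ ω ∂P, TendstoDM (fun n => X n ω) (Xinf ω)) :
    (∀ᵐ ω ∂P, ∀ u : Node,
      0 < (Xinf ω : Measure NodeBar).real (cyl u) ∧ rho (Xinf ω) u ∈ simplex) ∧
    ∀ n : ℕ, 1 ≤ n → ∀ x : Finset Node, P (X n ⁻¹' {x}) ≠ 0 →
      (∀ u : Node,
        HasLaw (fun ω => rho (Xinf ω) u) (gem (childSizes x u)) (P[|X n ⁻¹' {x}])) ∧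
      iIndepFun (fun (u : Node) ω => rho (Xinf ω) u) (P[|X n ⁻¹' {x}]) := by
  constructor
  · filter_upwards [ae_all_iff.2 fun u => ae_mass_pos_restMass_pos hX hXinf_meas hXinf (u, 0),
      ae_rho_mem_simplex hX hXinf_meas hXinf] with ω h1 h2 u
    exact ⟨(h1 u).1, h2 u⟩
  intro n hn x hP
  have hx := isHarris_of_measure_ne_zero hX hn hP
  have hprob : ∀ u i, IsProbabilityMeasure (gemFactor (childSizes x u) i) :=
    hx.isProbabilityMeasure_gemFactor
  have hcond : IsProbabilityMeasure (P[|X n ⁻¹' {x}]) := cond_isProbabilityMeasure hP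
  have hac : P[|X n ⁻¹' {x}] ≪ P := cond_absolutelyContinuous
  have hlaw := hasLaw_fraction hX hXinf_meas hXinf hn hx hP
  -- Grouping the independent fractions by `u` turns the product measure over pairs into a product
  -- of product measures, which encodes both the law of each row and the independence of the rows.
  have hcurry : HasLaw (fun ω u i => fraction (Xinf ω) (u, i))
      (Measure.infinitePi fun u => Measure.infinitePi (gemFactor (childSizes x u)))
      (P[|X n ⁻¹' {x}]) := by
    refine HasLaw.comp (Y := MeasurableEquiv.curry Node ℕ ℝ) ⟨?_, ?_⟩ hlaw
    · exact (MeasurableEquiv.measurable _).aemeasurable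
    · exact Measure.infinitePi_map_curry fun u => gemFactor (childSizes x u)
  have hrow : ∀ u, HasLaw (fun ω i => fraction (Xinf ω) (u, i))
      (Measure.infinitePi (gemFactor (childSizes x u))) (P[|X n ⁻¹' {x}]) := fun u =>
    (measurePreserving_eval_infinitePi
      (fun u => Measure.infinitePi (gemFactor (childSizes x u))) u).comp_hasLaw hcurry
  have hindep : iIndepFun (fun u ω i => fraction (Xinf ω) (u, i)) (P[|X n ⁻¹' {x}]) :=
    (iIndepFun_iff_hasLaw_Pi_infinitePi hrow hcurry.aemeasurable).2 hcurry
  have hrho : ∀ u, (fun ω => rho (Xinf ω) u) =ᵐ[P[|X n ⁻¹' {x}]]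
      stickBreaking ∘ fun ω i => fraction (Xinf ω) (u, i) := fun u =>
    hac.ae_le ((ae_rho_eq_stickBreaking hX hXinf_meas hXinf).mono fun ω h => h u)
  refine ⟨fun u => ?_, ?_⟩
  · refine HasLaw.congr ?_ (hrho u)
    exact HasLaw.comp ⟨measurable_stickBreaking.aemeasurable, rfl⟩ (hrow u)
  · exact (iIndepFun_congr hrho).2 (hindep.comp _ fun _ => measurable_stickBreaking)
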